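/- Let $\Omega\subset\mathbb{R}^n$ be a bounded open set with Lipschitz boundary, $u_0\in L^2(\Omega)$, $\nu>0$, $c_1\ne c_2$ real and $k\ge 0$, and put $\theta_i=\frac1\nu(c_i-u_0)^2+k$ for $i=1,2$. (The constant $k$ does not affect which $\chi$ minimize $E$ below; $k=0$ gives the weights $\frac1\nu(c_i-u_0)^2$, and $k>0$ makes the weights bounded below by a positive constant.) For $w\in L^1(\Omega)$ let $|\mathrm{D}w|(\Omega)=\sup\{\int_\Omega w\,\mathrm{div}\,p\,dx : p\in C^1_c(\Omega;\mathbb{R}^n),\ |p|\le 1\}\in[0,\infty]$, and let $BV(\Omega,\{0,1\})$ be the set of $\chi\in L^1(\Omega)$ with values in $\{0,1\}$ almost everywhere and $|\mathrm{D}\chi|(\Omega)<\infty$. The binary Mumford–Shah functional is $$E[\chi]=\int_\Omega\theta_1\chi+\theta_2(1-\chi)\,dx+|\mathrm{D}\chi|(\Omega),\qquad \chi\in BV(\Omega,\{0,1\}).$$ For $v\in L^2(\Omega)$ let $$E^{\rm rel}[v]=\int_\Omega v^2\theta_1+(1-v)^2\theta_2\,dx+|\mathrm{D}v|(\Omega)\in[0,\infty].$$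 Let $H_N(\mathrm{div},\Omega)$ be the space of $q\in L^2(\Omega;\mathbb{R}^n)$ with weak divergence $\mathrm{div}\,q\in L^2(\Omega)$ and vanishing normal trace on $\partial\Omega$, i.e. $\int_\Omega q\cdot\nabla\varphi+\varphi\,\mathrm{div}\,q\,dx=0$ for all $\varphi\in C^\infty_c(\mathbb{R}^n)$. For $q\in H_N(\mathrm{div},\Omega)$ let $$D^{\rm rel}[q]=\int_\Omega\frac{\frac14(\mathrm{div}\,q)^2+\theta_2\,\mathrm{div}\,q-\theta_1\theta_2}{\theta_1+\theta_2}\,dx\quad\text{if }|q|\le1\text{ a.e. in }\Omega,\qquad D^{\rm rel}[q]=+\infty\quad\text{otherwise,}$$ and $$\mathrm{err}_u^2[v,q]=\frac{2\nu}{(c_1-c_2)^2}\left(E^{\rm rel}[v]+D^{\rm rel}[q]\right).$$ **Theorem.** Let $\chi\in BV(\Omega,\{0,1\})$ be any minimizer of $E$ over $BV(\Omega,\{0,1\})$. Then for all $v\in L^2(\Omega)$ and all $q\in H_N(\mathrm{div},\Omega)$, $$\left\|\chi-\chi_{[v>\frac12]}\right\|_{L^1(\Omega)}\le \inf_{\eta\in(0,\frac12)}\left(\left\|\chi_{[\frac12-\eta\le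 v\le\frac12+\eta]}\right\|_{L^1(\Omega)}+\frac1{\eta^2}\,\mathrm{err}_u^2[v,q]\right).$$ -/

import Mathlib

open MeasureTheory Set
open scoped ENNReal NNReal ContDiff

namespace BinaryMS

noncomputable section

/-- The Euclidean space `ℝⁿ`. -/
abbrev Space (n : ℕ) : Type := EuclideanSpace ℝ (Fin n)

/-- Bounded open sets with Lipschitz boundary: near every boundary point, `Ω` is the strict
epigraph of a Lipschitz function over a hyperplane `e^⊥`, with respect to a unit vector `e`.
(Only the values of `γ` on `e^⊥` matter.) -/
def IsBoundedLipschitz {n : ℕ} (Ω : Set (Space n)) : Prop :=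
  IsOpen Ω ∧ Bornology.IsBounded Ω ∧
    ∀ x ∈ frontier Ω, ∃ U : Set (Space n), IsOpen U ∧ x ∈ U ∧
      ∃ e : Space n, ‖e‖ = 1 ∧ ∃ (K : ℝ≥0) (γ : Space n → ℝ), LipschitzWith K γ ∧
        ∀ y ∈ U, (y ∈ Ω ↔ γ (y - inner ℝ e y • e) < inner ℝ e y)

/-- The classical divergence of a differentiable vector field. -/
def divergence {n : ℕ} (p : Space n → Space n) (x : Space n) : ℝ :=
  ∑ i : Fin n, (fderiv ℝ p x (EuclideanSpace.single i 1)) i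

/-- The fields admitted in the definition of the total variation:
`p ∈ C¹_c(Ω; ℝⁿ)` with `|p| ≤ 1` pointwise. -/
def tvFields {n : ℕ} (Ω : Set (Space n)) : Set (Space n → Space n) :=
  {p | ContDiff ℝ 1 p ∧ HasCompactSupport p ∧ tsupport p ⊆ Ω ∧ ∀ x, ‖p x‖ ≤ 1}

/-- The total variation `|Dw|(Ω) ∈ [0, ∞]` of `w ∈ L¹(Ω)`, that is, the supremum of
`∫_Ω w div p` over `tvFields Ω`. (This family contains `p = 0` and is closed under `p ↦ -p`, so
that passing to nonnegative parts does not change the supremum.) -/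
def totalVariation {n : ℕ} (Ω : Set (Space n)) (w : Space n → ℝ) : ℝ≥0∞ :=
  ⨆ p ∈ tvFields Ω, ENNReal.ofReal (∫ x in Ω, w x * divergence p x)

/-- `χ ∈ BV(Ω, {0,1})`. -/
def IsBinaryBV {n : ℕ} (Ω : Set (Space n)) (χ : Space n → ℝ) : Prop :=
  Integrable χ (volume.restrict Ω) ∧ totalVariation Ω χ < ⊤ ∧
    ∀ᵐ x ∂(volume.restrict Ω), χ x = 0 ∨ χ x = 1

/-- The weight `θ = (c - u₀)² / ν + k`; here `k` is the additive constant which may be added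
to both weights without changing the minimizers of the binary functional. -/
def weight {n : ℕ} (u₀ : Space n → ℝ) (ν k c : ℝ) (x : Space n) : ℝ :=
  1 / ν * (c - u₀ x) ^ 2 + k

/-- The binary Mumford-Shah functional `∫_Ω θ₁ χ + θ₂ (1 - χ) dx + |Dχ|(Ω)`
(for nonnegative weights). -/
def energy {n : ℕ} (Ω : Set (Space n)) (θ₁ θ₂ : Space n → ℝ) (χ : Space n → ℝ) : ℝ≥0∞ :=
  (∫⁻ x in Ω, ENNReal.ofReal (θ₁ x * χ x + θ₂ x * (1 - χ x))) + totalVariation Ω χ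

/-- `χ` is a minimizer of the binary Mumford-Shah functional over `BV(Ω, {0,1})`. -/
def IsBinaryMinimizer {n : ℕ} (Ω : Set (Space n)) (θ₁ θ₂ : Space n → ℝ)
    (χ : Space n → ℝ) : Prop :=
  IsBinaryBV Ω χ ∧ ∀ χ' : Space n → ℝ, IsBinaryBV Ω χ' → energy Ω θ₁ θ₂ χ ≤ energy Ω θ₁ θ₂ χ'

/-- The relaxed functional `E^rel[v] = ∫_Ω v² θ₁ + (1 - v)² θ₂ dx + |Dv|(Ω) ∈ [0, ∞]`
(for nonnegative weights). -/
def relEnergy {n : ℕ} (Ω : Set (Space n)) (θ₁ θ₂ : Space n → ℝ) (v : Space n → ℝ) : ℝ≥0∞ :=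
  (∫⁻ x in Ω, ENNReal.ofReal (v x ^ 2 * θ₁ x + (1 - v x) ^ 2 * θ₂ x)) + totalVariation Ω v

/-- `g ∈ L²(Ω)` is the weak divergence of `q` in `Ω`. -/
def IsWeakDiv {n : ℕ} (Ω : Set (Space n)) (q : Space n → Space n) (g : Space n → ℝ) : Prop :=
  MemLp g 2 (volume.restrict Ω) ∧
    ∀ φ : Space n → ℝ, ContDiff ℝ ∞ φ → HasCompactSupport φ → tsupport φ ⊆ Ω →
      ∫ x in Ω, fderiv ℝ φ x (q x) = - ∫ x in Ω, g x * φ x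

open Classical in
/-- The weak divergence of `q` in `Ω` (unique up to null sets; `0` if there is none in `L²`). -/
def weakDiv {n : ℕ} (Ω : Set (Space n)) (q : Space n → Space n) : Space n → ℝ :=
  if h : ∃ g, IsWeakDiv Ω q g then h.choose else 0

/-- `q ∈ H(div, Ω)`. -/
def MemHdiv {n : ℕ} (Ω : Set (Space n)) (q : Space n → Space n) : Prop :=
  MemLp q 2 (volume.restrict Ω) ∧ ∃ g, IsWeakDiv Ω q g

/-- `q ∈ H_N(div, Ω)`: the normal trace `q · ν` on `∂Ω`, which is the functional
`φ ↦ ∫_Ω q · ∇φ + φ div q dx` on functions smooth up to the boundary, vanishes. -/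
def MemHN {n : ℕ} (Ω : Set (Space n)) (q : Space n → Space n) : Prop :=
  MemHdiv Ω q ∧
    ∀ φ : Space n → ℝ, ContDiff ℝ ∞ φ → HasCompactSupport φ →
      ∫ x in Ω, (fderiv ℝ φ x (q x) + φ x * weakDiv Ω q x) = 0

open Classical in
/-- The indicator functional `F` of the constraint `|q| ≤ 1` almost everywhere in `Ω`. -/
def dualF {n : ℕ} (Ω : Set (Space n)) (q : Space n → Space n) : EReal :=
  if ∀ᵐ x ∂(volume.restrict Ω), ‖q x‖ ≤ 1 then 0 else ⊤

/-- The functional `G` on `L²(Ω)`. (The integrand is integrable if `θ₁, θ₂ ≥ 0` are integrable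
and `θ₁ + θ₂` is bounded below by a positive constant.) -/
def dualG {n : ℕ} (Ω : Set (Space n)) (θ₁ θ₂ : Space n → ℝ) (w : Space n → ℝ) : ℝ :=
  ∫ x in Ω, (1 / 4 * w x ^ 2 + w x * θ₂ x - θ₁ x * θ₂ x) / (θ₁ x + θ₂ x)

/-- The predual functional `D^rel[q] = F[q] + G[div q]`. -/
def dualEnergy {n : ℕ} (Ω : Set (Space n)) (θ₁ θ₂ : Space n → ℝ)
    (q : Space n → Space n) : EReal :=
  dualF Ω q + (dualG Ω θ₁ θ₂ (weakDiv Ω q) : EReal)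

/-- The squared relaxed error estimator
`err_u²[v,q] = 2ν / (c₁ - c₂)² * (E^rel[v] + D^rel[q])` (for `c₁ ≠ c₂`). -/
def errUSq {n : ℕ} (Ω : Set (Space n)) (u₀ : Space n → ℝ) (ν k c₁ c₂ : ℝ)
    (v : Space n → ℝ) (q : Space n → Space n) : EReal :=
  ((2 * ν / (c₁ - c₂) ^ 2 : ℝ) : EReal) *
    ((relEnergy Ω (weight u₀ ν k c₁) (weight u₀ ν k c₂) v : EReal) +
      dualEnergy Ω (weight u₀ ν k c₁) (weight u₀ ν k c₂) q)

/-- `a[v,η] = ‖χ_{[1/2 - η ≤ v ≤ 1/2 + η]}‖_{L¹(Ω)}`. -/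
def unidentified {n : ℕ} (Ω : Set (Space n)) (v : Space n → ℝ) (η : ℝ) : ℝ≥0∞ :=
  eLpNorm (indicator {x | 1 / 2 - η ≤ v x ∧ v x ≤ 1 / 2 + η} (fun _ => (1 : ℝ))) 1
    (volume.restrict Ω)

/-- The estimator `err_χ[v,q] = inf_{0 < η < 1/2} (a[v,η] + η⁻² err_u²[v,q])`. -/
def errChi {n : ℕ} (Ω : Set (Space n)) (u₀ : Space n → ℝ) (ν k c₁ c₂ : ℝ)
    (v : Space n → ℝ) (q : Space n → Space n) : EReal :=
  ⨅ η ∈ Ioo (0 : ℝ) (1 / 2),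
    ((unidentified Ω v η : EReal) + ((1 / η ^ 2 : ℝ) : EReal) * errUSq Ω u₀ ν k c₁ c₂ v q)

end

end BinaryMS

/-!
Neither a minimizer of the relaxed functional nor the coarea formula is needed; everything rests on
the submodularity `|D min(w, z)| + |D max(w, z)| ≤ |Dw| + |Dz|` of the total variation
(`TVLe.exists_min_max`) and its lower semicontinuity.

Put `g = θ₁ - θ₂` and `F(w) = ∫ g w + |Dw|(Ω)`, which is the binary functional up to a constant.
Cutting a `[0, 1]`-valued `w` at a level writes it as a convex combination of two truncations whose
values of `F` average, by submodularity, to at most `F(w)`. Iterating such cuts and passing to the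
limit produces a `{0, 1}`-valued function with no larger value of `F` (`EnergyLe.exists_binary`).
Hence the binary minimizer `χ` minimizes `F` among `[0, 1]`-valued functions too.

Let `v` be truncated to `[0, 1]`, and let `V = max(v, 1/2)` on `{χ = 1}` and `V = min(v, 1/2)` on
`{χ = 0}`. Minimality of `χ` and submodularity give `F(V) ≤ F(v)` (`EnergyLe.rearrange`). Since
`(V - 1/2)(v - V) = 0`, expanding the quadratic terms around `1/2` turns this into
`E^rel[v] - E^rel[V] ≥ ∫ (θ₁ + θ₂)(v - V)²`. Weak duality `E^rel[V] + D^rel[q] ≥ 0` and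
`θ₁ + θ₂ ≥ (c₁ - c₂)² / (2ν)` then yield `∫ (v - V)² ≤ err_u²[v, q]` (`mul_integral_sq_le`). Where
`χ` and `χ_{[v > 1/2]}` differ, either `|v - 1/2| ≤ η`, or `V = 1/2` and `|v - V| ≥ η`
(`abs_sub_indicator_le`), and the estimate follows.

Weak duality is the inequality `-∫ V div q ≤ |DV|(Ω)` for `q ∈ H_N(div, Ω)` with `|q| ≤ 1`
(`TVLe.neg_integral_mul_weakDiv_le`), the only place where the Lipschitz boundary matters. By the
vanishing normal trace, the extension of `q` by zero has a weak divergence on `ℝⁿ`. Localized by a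
partition of unity, translated into `Ω` along the directions supplied by the Lipschitz condition,
and mollified, it becomes a `C¹` field with compact support in `Ω` and norm at most `1 + O(ε)`.
-/

namespace BinaryMS

open Filter Topology Convolution

/-! ### Translations and mollifiers in `L¹` -/

/-- Translations act continuously on `L¹`. -/
theorem tendsto_integral_norm_translate_sub {n : ℕ} {f : Space n → ℝ} (hf : Integrable f) :
    Tendsto (fun y => ∫ x, ‖f (x - y) - f x‖) (𝓝 0) (𝓝 0) := by
  have : Fact ((1 : ℝ≥0∞) ≠ ⊤) := ⟨ENNReal.one_ne_top⟩
  have hc : Continuous fun y : Space n => (DomAddAct.mk (-y)) +ᵥ hf.toL1 f := by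
    have : Continuous fun y : Space n => DomAddAct.mk (-y) :=
      DomAddAct.continuous_mk.comp continuous_neg
    exact this.vadd continuous_const
  have h2 : Tendsto (fun y : Space n => ‖(DomAddAct.mk (-y) +ᵥ hf.toL1 f) - hf.toL1 f‖) (𝓝 0)
      (𝓝 0) := by
    have h0 : (DomAddAct.mk (-(0 : Space n)) +ᵥ hf.toL1 f) - hf.toL1 f = 0 := by
      rw [neg_zero, sub_eq_zero]
      exact zero_vadd _ _
    have h1 := (hc.sub (continuous_const (y := hf.toL1 f))).norm.tendsto 0
    simp only [Pi.sub_apply] at h1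
    rwa [h0, norm_zero] at h1
  refine h2.congr fun y => ?_
  rw [L1.norm_eq_integral_norm]
  refine integral_congr_ae ?_
  have h3 := hf.coeFn_toL1
  have h4 : ∀ᵐ x : Space n, (hf.toL1 f) (-y + x) = f (-y + x) :=
    (measurePreserving_add_left volume (-y)).quasiMeasurePreserving.ae h3
  have h5 : ((DomAddAct.mk (-y) +ᵥ hf.toL1 f : Lp ℝ 1 volume) : Space n → ℝ) =ᵐ[volume]
      fun x => (hf.toL1 f) (-y + x) := DomAddAct.vadd_Lp_ae_eq _ _
  filter_upwards [Lp.coeFn_sub (DomAddAct.mk (-y) +ᵥ hf.toL1 f) (hf.toL1 f), h3, h4, h5] with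
    x e1 e2 e3 e4
  rw [e1, Pi.sub_apply, e4, e3, e2, neg_add_eq_sub]

/-- A smooth probability density supported in the closed ball of center `z` and radius `ρ`. -/
structure IsMollifier {n : ℕ} (κ : Space n → ℝ) (z : Space n) (ρ : ℝ) : Prop where
  contDiff : ContDiff ℝ ∞ κ
  nonneg : ∀ y, 0 ≤ κ y
  integral_eq_one : ∫ y, κ y = 1
  tsupport_subset : tsupport κ ⊆ Metric.closedBall z ρ

theorem exists_isMollifier {n : ℕ} (z : Space n) {ρ : ℝ} (hρ : 0 < ρ) :
    ∃ κ : Space n → ℝ, IsMollifier κ z ρ := by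
  let φ : ContDiffBump z := ⟨ρ / 2, ρ, by linarith, by linarith⟩
  exact ⟨φ.normed volume, φ.contDiff_normed, φ.nonneg_normed, φ.integral_normed,
    φ.tsupport_normed_eq.subset⟩

namespace IsMollifier

variable {n : ℕ} {κ : Space n → ℝ} {z : Space n} {ρ : ℝ}

theorem hasCompactSupport (hκ : IsMollifier κ z ρ) : HasCompactSupport κ :=
  (isCompact_closedBall z ρ).of_isClosed_subset (isClosed_tsupport κ) hκ.tsupport_subset

theorem integrable (hκ : IsMollifier κ z ρ) : Integrable κ :=
  hκ.contDiff.continuous.integrable_of_hasCompactSupport hκ.hasCompactSupport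

theorem mem_of_ne_zero (hκ : IsMollifier κ z ρ) {y : Space n} (hy : κ y ≠ 0) :
    y ∈ Metric.closedBall z ρ :=
  hκ.tsupport_subset (subset_tsupport _ hy)

theorem integrable_convolution (hκ : IsMollifier κ z ρ) {f : Space n → ℝ} (hf : Integrable f) :
    Integrable (κ ⋆[ContinuousLinearMap.lsmul ℝ ℝ] f) :=
  hκ.integrable.integrable_convolution _ hf

theorem integral_norm_convolution_sub_le (hκ : IsMollifier κ z ρ) {f : Space n → ℝ}
    (hf : Integrable f) {ε : ℝ}
    (hε : ∀ y ∈ Metric.closedBall z ρ, ∫ x, ‖f (x - y) - f x‖ ≤ ε) :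
    ∫ x, ‖(κ ⋆[ContinuousLinearMap.lsmul ℝ ℝ] f) x - f x‖ ≤ ε := by
  have I1 : Integrable (fun p : Space n × Space n => κ p.2 * f (p.1 - p.2)) :=
    hκ.integrable.convolution_integrand (ContinuousLinearMap.lsmul ℝ ℝ) hf
  have I2 : Integrable (fun p : Space n × Space n => κ p.2 * f p.1) := by
    exact (hf.mul_prod hκ.integrable).congr (Eventually.of_forall fun p => mul_comm _ _)
  have I3 : Integrable (fun p : Space n × Space n => κ p.2 * ‖f (p.1 - p.2) - f p.1‖) := by
    refine (I1.sub I2).norm.congr (Eventually.of_forall fun p => ?_)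
    simp only [Pi.sub_apply, ← mul_sub, norm_mul, Real.norm_of_nonneg (hκ.nonneg _)]
  have hpt : ∀ᵐ x : Space n, ‖(κ ⋆[ContinuousLinearMap.lsmul ℝ ℝ] f) x - f x‖ ≤
      ∫ y, κ y * ‖f (x - y) - f x‖ := by
    filter_upwards [I1.prod_right_ae] with x hx
    have : (κ ⋆[ContinuousLinearMap.lsmul ℝ ℝ] f) x - f x =
        ∫ y, κ y * (f (x - y) - f x) := by
      simp only [mul_sub]
      rw [integral_sub hx (hκ.integrable.mul_const _), integral_mul_const, hκ.integral_eq_one,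
        one_mul]
      rfl
    rw [this]
    refine (norm_integral_le_integral_norm _).trans_eq ?_
    simp only [norm_mul, Real.norm_of_nonneg (hκ.nonneg _)]
  calc _ ≤ ∫ x, ∫ y, κ y * ‖f (x - y) - f x‖ :=
        integral_mono_ae (((hκ.integrable_convolution hf).sub hf).norm) I3.integral_prod_left hpt
    _ = ∫ y, κ y * ∫ x, ‖f (x - y) - f x‖ := by
        rw [integral_integral_swap I3]; simp only [integral_const_mul]
    _ ≤ ∫ y, κ y * ε := by
        refine integral_mono_ae ?_ (hκ.integrable.mul_const _) (Eventually.of_forall fun y => ?_)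
        · simpa only [integral_const_mul] using I3.integral_prod_right
        · by_cases hy : κ y = 0
          · simp [hy]
          · exact mul_le_mul_of_nonneg_left (hε y (hκ.mem_of_ne_zero hy)) (hκ.nonneg y)
    _ = ε := by rw [integral_mul_const, hκ.integral_eq_one, one_mul]

/-- A convolution tested with a function `g` is an average of tests with translates of `g`. -/
theorem integral_convolution_mul (hκ : IsMollifier κ z ρ) {f g : Space n → ℝ} (hf : Integrable f)
    (hg : Continuous g) {B : ℝ} (hB : ∀ x, ‖g x‖ ≤ B) :
    ∫ x, (κ ⋆[ContinuousLinearMap.lsmul ℝ ℝ] f) x * g x = ∫ y, κ y * ∫ x, f x * g (x + y) := by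
  have I1 : Integrable (fun p : Space n × Space n => κ p.2 * f (p.1 - p.2)) :=
    hκ.integrable.convolution_integrand (ContinuousLinearMap.lsmul ℝ ℝ) hf
  have I2 : Integrable (fun p : Space n × Space n => κ p.2 * f (p.1 - p.2) * g p.1) :=
    I1.mul_bdd (hg.comp continuous_fst).aestronglyMeasurable
      (Eventually.of_forall fun p => hB p.1)
  calc _ = ∫ x, ∫ y, κ y * f (x - y) * g x := by
        refine integral_congr_ae (Eventually.of_forall fun x => ?_)
        simp only [convolution, ContinuousLinearMap.lsmul_apply, smul_eq_mul]
        rw [integral_mul_const]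
    _ = ∫ y, ∫ x, κ y * f (x - y) * g x := integral_integral_swap I2
    _ = _ := by
        refine integral_congr_ae (Eventually.of_forall fun y => ?_)
        simp only [mul_assoc, integral_const_mul]
        congr 1
        rw [← integral_sub_right_eq_self (fun x => f x * g (x + y)) y]
        simp

end IsMollifier

/-! ### Integration by parts and divergences of mollified fields -/

theorem integral_fderiv_apply {n : ℕ} {p : Space n → Space n} (hp : ContDiff ℝ 1 p)
    (hpc : HasCompactSupport p) {φ : Space n → ℝ} (hφ : ContDiff ℝ 1 φ) :
    ∫ x, fderiv ℝ φ x (p x) = - ∫ x, φ x * divergence p x := by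
  have hpi : ∀ i, ContDiff ℝ 1 (fun x => p x i) := fun i => by fun_prop
  have hpci : ∀ i, HasCompactSupport (fun x => p x i) := fun i =>
    hpc.comp_left (g := fun v : Space n => v i) rfl
  have hcφ : Continuous (fderiv ℝ φ) := hφ.continuous_fderiv one_ne_zero
  have hd : ∀ i x, (fderiv ℝ p x (EuclideanSpace.single i 1)) i =
      fderiv ℝ (fun x => p x i) x (EuclideanSpace.single i 1) := by
    intro i x
    have h1 : HasFDerivAt p (fderiv ℝ p x) x :=
      (hp.differentiable one_ne_zero x).hasFDerivAt
    have h2 : HasFDerivAt (fun x => p x i) ((EuclideanSpace.proj i : Space n →L[ℝ] ℝ).comp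
      (fderiv ℝ p x)) x := (EuclideanSpace.proj i : Space n →L[ℝ] ℝ).hasFDerivAt.comp x h1
    rw [h2.fderiv]; rfl
  have I1 : ∀ i, Integrable fun x => fderiv ℝ φ x (EuclideanSpace.single i 1) * p x i := fun i =>
    ((hcφ.clm_apply continuous_const).mul (hpi i).continuous).integrable_of_hasCompactSupport
      (hpci i).mul_left
  have I2 : ∀ i, Integrable fun x =>
      φ x * fderiv ℝ (fun x => p x i) x (EuclideanSpace.single i 1) := fun i =>
    (hφ.continuous.mul (((hpi i).continuous_fderiv one_ne_zero).clm_apply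
      continuous_const)).integrable_of_hasCompactSupport
      ((hpci i).fderiv_apply (𝕜 := ℝ) _).mul_left
  have I3 : ∀ i, Integrable fun x => φ x * p x i := fun i =>
    (hφ.continuous.mul (hpi i).continuous).integrable_of_hasCompactSupport
      (hpci i).mul_left
  have e1 : ∀ x, fderiv ℝ φ x (p x) =
      ∑ i, fderiv ℝ φ x (EuclideanSpace.single i 1) * p x i := by
    intro x
    conv_lhs => rw [← (EuclideanSpace.basisFun (Fin n) ℝ).sum_repr (p x)]
    simp [mul_comm]
  simp only [e1, divergence, hd, Finset.mul_sum]
  rw [integral_finsetSum _ fun i _ => I1 i, integral_finsetSum _ fun i _ => I2 i,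
    ← Finset.sum_neg_distrib]
  refine Finset.sum_congr rfl fun i _ => ?_
  rw [integral_mul_fderiv_eq_neg_fderiv_mul_of_integrable (I1 i) (I2 i) (I3 i)
    (fun x _ => hφ.differentiable one_ne_zero x)
    (fun x _ => (hpi i).differentiable one_ne_zero x), neg_neg]

theorem IsMollifier.contDiff_convolution {n : ℕ} {κ : Space n → ℝ} {z : Space n} {ρ : ℝ}
    (hκ : IsMollifier κ z ρ) {E : Type*} [NormedAddCommGroup E] [NormedSpace ℝ E]
    {F : Space n → E} (hF : Integrable F) :
    ContDiff ℝ 1 (κ ⋆[ContinuousLinearMap.lsmul ℝ ℝ] F) :=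
  hκ.hasCompactSupport.contDiff_convolution_left (n := 1) _ (hκ.contDiff.of_le (by simp))
    hF.locallyIntegrable

/-- Mollification turns a weak divergence on `ℝⁿ` into a classical one. -/
theorem IsMollifier.divergence_convolution {n : ℕ} {κ : Space n → ℝ} {z : Space n} {ρ : ℝ}
    (hκ : IsMollifier κ z ρ) {F : Space n → Space n} (hF : Integrable F) {f : Space n → ℝ}
    (hf : ∀ φ : Space n → ℝ, ContDiff ℝ ∞ φ → HasCompactSupport φ →
      ∫ x, fderiv ℝ φ x (F x) = - ∫ x, φ x * f x) (x : Space n) :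
    divergence (κ ⋆[ContinuousLinearMap.lsmul ℝ ℝ] F) x =
      (κ ⋆[ContinuousLinearMap.lsmul ℝ ℝ] f) x := by
  have hκ1 : ContDiff ℝ 1 κ := hκ.contDiff.of_le (by simp)
  have hD := hκ.hasCompactSupport.hasFDerivAt_convolution_left (ContinuousLinearMap.lsmul ℝ ℝ) hκ1
    hF.locallyIntegrable x
  have hI : Integrable (fun t => ((ContinuousLinearMap.lsmul ℝ ℝ).precompL (Space n))
      (fderiv ℝ κ t) (F (x - t))) :=
    (hκ.hasCompactSupport.fderiv (𝕜 := ℝ)).convolutionExists_left _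
      (hκ1.continuous_fderiv one_ne_zero) hF.locallyIntegrable x
  let T : (Space n →L[ℝ] Space n) →L[ℝ] ℝ := ∑ i : Fin n, (EuclideanSpace.proj i).comp
    (ContinuousLinearMap.apply ℝ (Space n) (EuclideanSpace.single i (1 : ℝ)))
  have hT : ∀ A : Space n →L[ℝ] Space n, T A = ∑ i, (A (EuclideanSpace.single i 1)) i := by
    intro A
    simp [T]
  have e1 : ∀ t, T (((ContinuousLinearMap.lsmul ℝ ℝ).precompL (Space n))
      (fderiv ℝ κ t) (F (x - t))) = fderiv ℝ κ t (F (x - t)) := by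
    intro t
    rw [hT]
    conv_rhs => rw [← (EuclideanSpace.basisFun (Fin n) ℝ).sum_repr (F (x - t))]
    simp [mul_comm]
  calc divergence (κ ⋆[ContinuousLinearMap.lsmul ℝ ℝ] F) x
      = T (∫ t, ((ContinuousLinearMap.lsmul ℝ ℝ).precompL (Space n))
          (fderiv ℝ κ t) (F (x - t))) := by
        rw [divergence, hD.fderiv, hT]; rfl
    _ = ∫ t, fderiv ℝ κ t (F (x - t)) := by
        rw [← T.integral_comp_comm hI]; simp only [e1]
    _ = ∫ y, fderiv ℝ κ (x - y) (F y) := by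
        rw [← integral_sub_left_eq_self _ volume x]; simp
    _ = - ∫ y, fderiv ℝ (fun y => κ (x - y)) y (F y) := by
        rw [← integral_neg]
        refine integral_congr_ae (Eventually.of_forall fun y => ?_)
        have h : HasFDerivAt (fun y => κ (x - y)) ((fderiv ℝ κ (x - y)).comp
            (-ContinuousLinearMap.id ℝ (Space n))) y :=
          (hκ1.differentiable one_ne_zero (x - y)).hasFDerivAt.comp y
            ((hasFDerivAt_id y).const_sub x)
        simp [h.fderiv]
    _ = ∫ y, κ (x - y) * f y := by
        rw [hf (fun y => κ (x - y)) (hκ.contDiff.comp (by fun_prop))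
          (hκ.hasCompactSupport.comp_homeomorph (Homeomorph.subLeft x)), neg_neg]
    _ = _ := by rw [convolution_eq_swap]; rfl

theorem continuous_divergence {n : ℕ} {p : Space n → Space n} (hp : ContDiff ℝ 1 p) :
    Continuous (divergence p) := by
  have h := hp.continuous_fderiv one_ne_zero
  unfold divergence
  fun_prop

theorem divergence_eq_zero_of_notMem {n : ℕ} {p : Space n → Space n} {x : Space n}
    (hx : x ∉ tsupport p) : divergence p x = 0 := by
  simp [divergence, fderiv_of_notMem_tsupport ℝ hx]

theorem hasCompactSupport_divergence {n : ℕ} {p : Space n → Space n}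
    (hp : HasCompactSupport p) : HasCompactSupport (divergence p) :=
  HasCompactSupport.intro hp fun _ hx => divergence_eq_zero_of_notMem hx

theorem exists_norm_divergence_le {n : ℕ} {p : Space n → Space n} (hp : ContDiff ℝ 1 p)
    (hpc : HasCompactSupport p) : ∃ B, ∀ x, ‖divergence p x‖ ≤ B :=
  (hasCompactSupport_divergence hpc).exists_bound_of_continuous (continuous_divergence hp)

theorem integrable_divergence {n : ℕ} {p : Space n → Space n} (hp : ContDiff ℝ 1 p)
    (hpc : HasCompactSupport p) : Integrable (divergence p) :=
  (continuous_divergence hp).integrable_of_hasCompactSupport (hasCompactSupport_divergence hpc)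

theorem integral_divergence {n : ℕ} {p : Space n → Space n} (hp : ContDiff ℝ 1 p)
    (hpc : HasCompactSupport p) : ∫ x, divergence p x = 0 := by
  simpa using (integral_fderiv_apply hp hpc (φ := fun _ => 1) contDiff_const).symm

theorem divergence_smul {n : ℕ} (c : ℝ) {p : Space n → Space n} (hp : ContDiff ℝ 1 p)
    (x : Space n) : divergence (fun y => c • p y) x = c * divergence p x := by
  have h : fderiv ℝ (fun y => c • p y) x = c • fderiv ℝ p x :=
    ((hp.differentiable one_ne_zero x).hasFDerivAt.const_smul c).fderiv
  simp [divergence, h, Finset.mul_sum]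

theorem divergence_comp_add_right {n : ℕ} (p : Space n → Space n) (y x : Space n) :
    divergence (fun x => p (x + y)) x = divergence p (x + y) := by
  simp [divergence, fderiv_comp_add_right]

theorem zero_mem_tvFields {n : ℕ} (Ω : Set (Space n)) : (fun _ => 0) ∈ tvFields Ω := by
  refine ⟨contDiff_const, HasCompactSupport.zero, ?_, fun x => by simp⟩
  have : tsupport (fun _ : Space n => (0 : Space n)) = ∅ := tsupport_eq_empty_iff.2 rfl
  simp [this]

theorem setIntegral_mul_divergence {n : ℕ} {Ω : Set (Space n)} {p : Space n → Space n}
    (hp : tsupport p ⊆ Ω) (w : Space n → ℝ) :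
    ∫ x in Ω, w x * divergence p x = ∫ x, w x * divergence p x :=
  setIntegral_eq_integral_of_forall_compl_eq_zero fun x hx => by
    rw [divergence_eq_zero_of_notMem fun h => hx (hp h), mul_zero]

theorem integrableOn_mul_divergence {n : ℕ} {Ω : Set (Space n)} {p : Space n → Space n}
    (hp : p ∈ tvFields Ω) {w : Space n → ℝ} (hw : IntegrableOn w Ω) :
    IntegrableOn (fun x => w x * divergence p x) Ω := by
  obtain ⟨B, hB⟩ := exists_norm_divergence_le hp.1 hp.2.1
  exact Integrable.mul_bdd hw (continuous_divergence hp.1).aestronglyMeasurable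
    (Eventually.of_forall hB)

/-! ### Total variation bounds -/

/-- The total variation of `w` on `Ω` is at most the real number `C`: all admissible test fields
give at most `C`. Working with such real bounds avoids extended nonnegative arithmetic. -/
def TVLe {n : ℕ} (Ω : Set (Space n)) (w : Space n → ℝ) (C : ℝ) : Prop :=
  ∀ p ∈ tvFields Ω, ∫ x in Ω, w x * divergence p x ≤ C

namespace TVLe

variable {n : ℕ} {Ω : Set (Space n)} {w z : Space n → ℝ} {a b C : ℝ}

theorem nonneg (h : TVLe Ω w C) : 0 ≤ C := by
  simpa [divergence] using h _ (zero_mem_tvFields Ω)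

theorem mono (h : TVLe Ω w a) (hab : a ≤ b) : TVLe Ω w b := fun p hp => (h p hp).trans hab

theorem totalVariation_le (h : TVLe Ω w C) : totalVariation Ω w ≤ ENNReal.ofReal C :=
  iSup₂_le fun p hp => ENNReal.ofReal_le_ofReal (h p hp)

theorem of_totalVariation_lt_top (h : totalVariation Ω w < ⊤) :
    TVLe Ω w (totalVariation Ω w).toReal := fun p hp => by
  rw [← ENNReal.ofReal_le_iff_le_toReal h.ne]
  exact le_iSup₂ (f := fun p (_ : p ∈ tvFields Ω) =>
    ENNReal.ofReal (∫ x in Ω, w x * divergence p x)) p hp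

theorem congr_ae (h : TVLe Ω w C) (hwz : w =ᵐ[volume.restrict Ω] z) : TVLe Ω z C := fun p hp => by
  have e : ∫ x in Ω, z x * divergence p x = ∫ x in Ω, w x * divergence p x :=
    integral_congr_ae (hwz.mono fun x hx => by simp only [hx])
  exact e.trans_le (h p hp)

theorem affine (h : TVLe Ω w C) (hw : IntegrableOn w Ω) (ha : 0 ≤ a) (b : ℝ) :
    TVLe Ω (fun x => a * w x + b) (a * C) := fun p hp => by
  have e : ∫ x in Ω, (a * w x + b) * divergence p x = a * ∫ x in Ω, w x * divergence p x := by
    have h0 : ∫ x in Ω, b * divergence p x = 0 := by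
      rw [setIntegral_mul_divergence hp.2.2.1 (fun _ => b), integral_const_mul,
        integral_divergence hp.1 hp.2.1, mul_zero]
    have : ∀ x, (a * w x + b) * divergence p x =
        a * (w x * divergence p x) + b * divergence p x := fun x => by ring
    simp only [this]
    rw [integral_add ((integrableOn_mul_divergence hp hw).const_mul a)
      ((integrable_divergence hp.1 hp.2.1).integrableOn.const_mul b), h0, integral_const_mul,
      add_zero]
  rw [e]
  exact mul_le_mul_of_nonneg_left (h p hp) ha

theorem const (Ω : Set (Space n)) (b : ℝ) : TVLe Ω (fun _ => b) 0 := by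
  have h : TVLe Ω (fun _ => 0) 0 := fun p _ => by simp
  simpa using h.affine (integrableOn_zero) zero_le_one b

/-- Lower semicontinuity of the total variation along bounded pointwise convergence. -/
theorem of_tendsto {u : ℕ → Space n → ℝ} {c : ℕ → ℝ}
    (hu : ∀ k, AEStronglyMeasurable (u k) (volume.restrict Ω)) (hb : ∀ k x, |u k x| ≤ 1)
    (hlim : ∀ x, Tendsto (fun k => u k x) atTop (𝓝 (w x))) (hc : Tendsto c atTop (𝓝 C))
    (h : ∀ k, TVLe Ω (u k) (c k)) : TVLe Ω w C := fun p hp => by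
  refine le_of_tendsto_of_tendsto' (tendsto_integral_of_dominated_convergence
    (fun x => ‖divergence p x‖)
    (fun k => (hu k).mul (continuous_divergence hp.1).aestronglyMeasurable)
    (integrable_divergence hp.1 hp.2.1).norm.integrableOn
    (fun k => Eventually.of_forall fun x => ?_)
    (Eventually.of_forall fun x => (hlim x).mul_const _)) hc (fun k => h k p hp)
  rw [Pi.mul_apply, norm_mul]
  exact mul_le_of_le_one_left (norm_nonneg _) (hb k x)

/-- A mollification of `w` at scale `ρ` obeys the bound of `w` against fields whose support has
distance more than `ρ` from the complement of `Ω`: the convolution can be unfolded into translates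
of the field, each of which is an admissible field on `Ω`. -/
theorem integral_convolution_mul_divergence_le (h : TVLe Ω w C) (hΩ : MeasurableSet Ω)
    (hw : IntegrableOn w Ω) {κ : Space n → ℝ} {ρ : ℝ} (hκ : IsMollifier κ 0 ρ)
    {p : Space n → Space n} (hp : p ∈ tvFields Ω) (hρ : Metric.cthickening ρ (tsupport p) ⊆ Ω) :
    ∫ x, (κ ⋆[ContinuousLinearMap.lsmul ℝ ℝ] Ω.indicator w) x * divergence p x ≤ C := by
  obtain ⟨B, hB⟩ := exists_norm_divergence_le hp.1 hp.2.1
  rw [hκ.integral_convolution_mul (hw.integrable_indicator hΩ) (continuous_divergence hp.1) hB]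
  by_cases hI : Integrable fun y => κ y * ∫ x, Ω.indicator w x * divergence p (x + y)
  swap
  · rw [integral_undef hI]; exact h.nonneg
  have key : ∀ y, κ y * ∫ x, Ω.indicator w x * divergence p (x + y) ≤ κ y * C := by
    intro y
    by_cases hy : κ y = 0
    · simp [hy]
    refine mul_le_mul_of_nonneg_left ?_ (hκ.nonneg y)
    have hyρ : ‖y‖ ≤ ρ := by simpa using hκ.mem_of_ne_zero hy
    have hs : tsupport (fun x => p (x + y)) = (Homeomorph.addRight y) ⁻¹' tsupport p :=
      tsupport_comp_eq_preimage p (Homeomorph.addRight y)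
    have hmem : (fun x => p (x + y)) ∈ tvFields Ω := by
      refine ⟨hp.1.comp (by fun_prop), hp.2.1.comp_homeomorph (Homeomorph.addRight y), ?_,
        fun x => hp.2.2.2 _⟩
      rw [hs]
      intro x hx
      refine hρ (Metric.mem_cthickening_of_dist_le x (x + y) ρ _ hx ?_)
      simpa [dist_eq_norm] using hyρ
    refine le_trans (le_of_eq ?_) (h _ hmem)
    rw [← integral_indicator hΩ]
    refine integral_congr_ae (Eventually.of_forall fun x => ?_)
    by_cases hx : x ∈ Ω <;> simp [hx, divergence_comp_add_right]
  calc _ ≤ ∫ y, κ y * C := integral_mono hI (hκ.integrable.mul_const C) key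
    _ = C := by rw [integral_mul_const, hκ.integral_eq_one, one_mul]

end TVLe

/-! ### Submodularity of the total variation -/

/-- The smooth approximations `(a + b ∓ √((a - b)² + ε²)) / 2` of `min` and `max` have gradients
that are complementary convex combinations of the gradients of `a` and `b`. The weights can be moved
onto the test fields `p₁`, `p₂`, which are thereby replaced by convex combinations `P`, `Q`. -/
theorem exists_fields_of_smooth_min_max {n : ℕ} {Ω : Set (Space n)} {W Z : Space n → ℝ}
    (hW : ContDiff ℝ 1 W) (hZ : ContDiff ℝ 1 Z) {ε : ℝ} (hε : 0 < ε) {p₁ p₂ : Space n → Space n}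
    (h₁ : p₁ ∈ tvFields Ω) (h₂ : p₂ ∈ tvFields Ω) :
    ∃ P ∈ tvFields Ω, ∃ Q ∈ tvFields Ω, tsupport P ⊆ tsupport p₁ ∪ tsupport p₂ ∧
      tsupport Q ⊆ tsupport p₁ ∪ tsupport p₂ ∧
      (∫ x, (W x + Z x - √((W x - Z x) ^ 2 + ε ^ 2)) / 2 * divergence p₁ x) +
        ∫ x, (W x + Z x + √((W x - Z x) ^ 2 + ε ^ 2)) / 2 * divergence p₂ x =
      (∫ x, W x * divergence P x) + ∫ x, Z x * divergence Q x := by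
  set r : Space n → ℝ := fun x => √((W x - Z x) ^ 2 + ε ^ 2) with hr
  have hpos : ∀ x, 0 < (W x - Z x) ^ 2 + ε ^ 2 := fun x => by positivity
  have hrpos : ∀ x, 0 < r x := fun x => Real.sqrt_pos.2 (hpos x)
  have hrc : ContDiff ℝ 1 r := (by fun_prop : ContDiff ℝ 1 fun x => (W x - Z x) ^ 2 + ε ^ 2).sqrt
    fun x => (hpos x).ne'
  -- `l` is the weight of `∇W` in the gradient of the approximate minimum
  set l : Space n → ℝ := fun x => (1 - (W x - Z x) / r x) / 2 with hl
  have hlc : ContDiff ℝ 1 l :=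
    (contDiff_const.sub ((hW.sub hZ).div hrc fun x => (hrpos x).ne')).div_const 2
  have hs : ∀ x, |(W x - Z x) / r x| ≤ 1 := fun x => by
    rw [abs_div, abs_of_pos (hrpos x), div_le_one (hrpos x)]
    exact Real.abs_le_sqrt (by nlinarith)
  have hl0 : ∀ x, 0 ≤ l x := fun x => by have := abs_le.1 (hs x); simp only [hl]; linarith
  have hl1 : ∀ x, l x ≤ 1 := fun x => by have := abs_le.1 (hs x); simp only [hl]; linarith
  have hconv : ∀ t : Space n → ℝ, ContDiff ℝ 1 t → (∀ x, 0 ≤ t x) → (∀ x, t x ≤ 1) →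
      (fun x => t x • p₁ x + (1 - t x) • p₂ x) ∈ tvFields Ω ∧
      tsupport (fun x => t x • p₁ x + (1 - t x) • p₂ x) ⊆ tsupport p₁ ∪ tsupport p₂ := by
    intro t ht h0 h1
    have hsub : tsupport (fun x => t x • p₁ x + (1 - t x) • p₂ x) ⊆ tsupport p₁ ∪ tsupport p₂ :=
      (tsupport_add (fun x => t x • p₁ x) (fun x => (1 - t x) • p₂ x)).trans
        (union_subset_union (tsupport_smul_subset_right _ _) (tsupport_smul_subset_right _ _))
    have hcont : ContDiff ℝ 1 fun x => t x • p₁ x + (1 - t x) • p₂ x :=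
      (ht.smul h₁.1).add ((contDiff_const.sub ht).smul h₂.1)
    have hcomp : HasCompactSupport fun x => t x • p₁ x + (1 - t x) • p₂ x :=
      (h₁.2.1.union h₂.2.1).of_isClosed_subset (isClosed_tsupport _) hsub
    refine ⟨⟨hcont, hcomp, hsub.trans (union_subset h₁.2.2.1 h₂.2.2.1), fun x => ?_⟩, hsub⟩
    refine (norm_add_le _ _).trans ?_
    rw [norm_smul, norm_smul, Real.norm_of_nonneg (h0 x),
      Real.norm_of_nonneg (sub_nonneg.2 (h1 x))]
    nlinarith [h₁.2.2.2 x, h₂.2.2.2 x, h0 x, h1 x]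
  obtain ⟨hP, hPs⟩ := hconv l hlc hl0 hl1
  obtain ⟨hQ, hQs⟩ := hconv (fun x => 1 - l x) (contDiff_const.sub hlc)
    (fun x => sub_nonneg.2 (hl1 x)) (fun x => by linarith [hl0 x])
  refine ⟨_, hP, _, hQ, hPs, hQs, ?_⟩
  have hmc : ContDiff ℝ 1 fun x => (W x + Z x - r x) / 2 := ((hW.add hZ).sub hrc).div_const 2
  have hMc : ContDiff ℝ 1 fun x => (W x + Z x + r x) / 2 := ((hW.add hZ).add hrc).div_const 2
  have int : ∀ {φ : Space n → ℝ} {p : Space n → Space n}, ContDiff ℝ 1 φ → p ∈ tvFields Ω →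
      Integrable fun x => fderiv ℝ φ x (p x) := by
    intro φ p hφ hp
    refine ((hφ.continuous_fderiv one_ne_zero).clm_apply
      hp.1.continuous).integrable_of_hasCompactSupport (hp.2.1.mono' ?_)
    intro x hx
    refine subset_tsupport _ fun h => hx ?_
    simp only [h, map_zero]
  have ibp : ∀ {φ : Space n → ℝ} {p : Space n → Space n}, ContDiff ℝ 1 φ → p ∈ tvFields Ω →
      ∫ x, φ x * divergence p x = - ∫ x, fderiv ℝ φ x (p x) := fun hφ hp => by
    rw [integral_fderiv_apply hp.1 hp.2.1 hφ, neg_neg]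
  rw [ibp hmc h₁, ibp hMc h₂, ibp hW hP, ibp hZ hQ, ← neg_add, ← neg_add,
    ← integral_add (int hmc h₁) (int hMc h₂), ← integral_add (int hW hP) (int hZ hQ)]
  congr 1
  refine integral_congr_ae (Eventually.of_forall fun x => ?_)
  have dW := (hW.differentiable one_ne_zero x).hasFDerivAt
  have dZ := (hZ.differentiable one_ne_zero x).hasFDerivAt
  have dr : HasFDerivAt r (((W x - Z x) / r x) • (fderiv ℝ W x - fderiv ℝ Z x)) x := by
    have := (((dW.sub dZ).pow 2).add_const (ε ^ 2)).sqrt (hpos x).ne'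
    refine this.congr_fderiv ?_
    ext v
    have h0 := (hrpos x).ne'
    simp only [hr] at h0 ⊢
    simp
    field_simp
  have dm : HasFDerivAt (fun x => (W x + Z x - r x) / 2) _ x :=
    ((dW.add dZ).sub dr).mul_const (2⁻¹ : ℝ)
  have dM : HasFDerivAt (fun x => (W x + Z x + r x) / 2) _ x :=
    ((dW.add dZ).add dr).mul_const (2⁻¹ : ℝ)
  simp only [dm.fderiv, dM.fderiv, hl]
  simp
  ring

theorem abs_min_max_sub_smooth_le (a b a' b' : ℝ) {ε : ℝ} (hε : 0 ≤ ε) :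
    |min a b - (a' + b' - √((a' - b') ^ 2 + ε ^ 2)) / 2| ≤ |a' - a| + |b' - b| + ε ∧
    |max a b - (a' + b' + √((a' - b') ^ 2 + ε ^ 2)) / 2| ≤ |a' - a| + |b' - b| + ε := by
  have h1 : |a' - b'| ≤ √((a' - b') ^ 2 + ε ^ 2) := Real.abs_le_sqrt (by nlinarith)
  have h2 : √((a' - b') ^ 2 + ε ^ 2) ≤ |a' - b'| + ε := by
    rw [Real.sqrt_le_left (by positivity)]
    nlinarith [sq_abs (a' - b'), abs_nonneg (a' - b')]
  have h3 : |a - b| ≤ |a' - b'| + |a' - a| + |b' - b| := by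
    grind
  have h4 : |a' - b'| ≤ |a - b| + |a' - a| + |b' - b| := by
    grind
  have h5 := neg_abs_le (a' - a)
  have h6 := neg_abs_le (b' - b)
  have h7 := le_abs_self (a' - a)
  have h8 := le_abs_self (b' - b)
  have hmin : min a b = (a + b - |a - b|) / 2 := by grind
  have hmax : max a b = (a + b + |a - b|) / 2 := by grind
  rw [hmin, hmax, abs_le, abs_le]
  refine ⟨⟨?_, ?_⟩, ?_, ?_⟩ <;> linarith

/-- Replacing `f` by an approximation `m` changes the integral against a divergence by `O(ε)`. -/
theorem integral_mul_divergence_le_of_approx {n : ℕ} {p : Space n → Space n}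
    (hp : ContDiff ℝ 1 p) (hpc : HasCompactSupport p) {B : ℝ} (hB : ∀ x, ‖divergence p x‖ ≤ B)
    {f m E : Space n → ℝ} (hf : Integrable f) (hm : Continuous m) (hE : Integrable E) {ε : ℝ}
    (hfm : ∀ x, |f x - m x| ≤ E x + ε) (hE0 : ∀ x, 0 ≤ E x) (hEε : ∫ x, E x ≤ 2 * ε) :
    ∫ x, f x * divergence p x ≤ (∫ x, m x * divergence p x) +
      (2 * B + ∫ x, ‖divergence p x‖) * ε := by
  have hd := continuous_divergence hp
  have I1 : Integrable fun x => f x * divergence p x :=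
    hf.mul_bdd hd.aestronglyMeasurable (Eventually.of_forall hB)
  have I2 : Integrable fun x => m x * divergence p x :=
    (hm.mul hd).integrable_of_hasCompactSupport (hasCompactSupport_divergence hpc).mul_left
  have I3 : Integrable fun x => E x * B + ε * ‖divergence p x‖ :=
    (hE.mul_const B).add ((integrable_divergence hp hpc).norm.const_mul ε)
  have hB0 : 0 ≤ B := (norm_nonneg _).trans (hB 0)
  have key : (∫ x, f x * divergence p x) - (∫ x, m x * divergence p x) ≤
      ∫ x, (E x * B + ε * ‖divergence p x‖) := by
    rw [← integral_sub I1 I2]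
    refine integral_mono (I1.sub I2) I3 fun x => ?_
    simp only [← sub_mul]
    calc (f x - m x) * divergence p x ≤ |f x - m x| * ‖divergence p x‖ := by
          rw [Real.norm_eq_abs, ← abs_mul]; exact le_abs_self _
      _ ≤ (E x + ε) * ‖divergence p x‖ := mul_le_mul_of_nonneg_right (hfm x) (norm_nonneg _)
      _ ≤ E x * B + ε * ‖divergence p x‖ := by
          rw [add_mul]
          exact add_le_add_left (mul_le_mul_of_nonneg_left (hB x) (hE0 x)) _
  rw [integral_add (hE.mul_const B) ((integrable_divergence hp hpc).norm.const_mul ε),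
    integral_mul_const, integral_const_mul] at key
  nlinarith

/-- Submodularity on a pair of test fields: `w` and `z` are mollified, `min` and `max` are smoothed,
and the fields of `exists_fields_of_smooth_min_max` are admissible for the mollifications because
their supports stay away from the boundary of `Ω`. -/
theorem TVLe.integral_min_add_integral_max_le {n : ℕ} {Ω : Set (Space n)} (hΩ : IsOpen Ω)
    {w z : Space n → ℝ} {a b : ℝ} (hw : IntegrableOn w Ω) (hz : IntegrableOn z Ω)
    (hwa : TVLe Ω w a) (hzb : TVLe Ω z b) {p₁ p₂ : Space n → Space n} (h₁ : p₁ ∈ tvFields Ω)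
    (h₂ : p₂ ∈ tvFields Ω) :
    (∫ x in Ω, min (w x) (z x) * divergence p₁ x) +
      ∫ x in Ω, max (w x) (z x) * divergence p₂ x ≤ a + b := by
  set W := Ω.indicator w with hWd
  set Z := Ω.indicator z with hZd
  have hW : Integrable W := hw.integrable_indicator hΩ.measurableSet
  have hZ : Integrable Z := hz.integrable_indicator hΩ.measurableSet
  have e1 : ∫ x in Ω, min (w x) (z x) * divergence p₁ x =
      ∫ x, min (W x) (Z x) * divergence p₁ x := by
    rw [← setIntegral_mul_divergence h₁.2.2.1]
    exact setIntegral_congr_fun hΩ.measurableSet fun x hx => by simp [hWd, hZd, hx]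
  have e2 : ∫ x in Ω, max (w x) (z x) * divergence p₂ x =
      ∫ x, max (W x) (Z x) * divergence p₂ x := by
    rw [← setIntegral_mul_divergence h₂.2.2.1]
    exact setIntegral_congr_fun hΩ.measurableSet fun x hx => by simp [hWd, hZd, hx]
  rw [e1, e2]
  obtain ⟨B₁, hB₁⟩ := exists_norm_divergence_le h₁.1 h₁.2.1
  obtain ⟨B₂, hB₂⟩ := exists_norm_divergence_le h₂.1 h₂.2.1
  obtain ⟨ρ₀, hρ₀, hρΩ⟩ := (h₁.2.1.union h₂.2.1 : IsCompact (tsupport p₁ ∪ tsupport p₂))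
    |>.exists_cthickening_subset_open hΩ (union_subset h₁.2.2.1 h₂.2.2.1)
  set A := (2 * B₁ + ∫ x, ‖divergence p₁ x‖) + (2 * B₂ + ∫ x, ‖divergence p₂ x‖) with hA
  have main : ∀ ε > 0, (∫ x, min (W x) (Z x) * divergence p₁ x) +
      ∫ x, max (W x) (Z x) * divergence p₂ x ≤ a + b + A * ε := by
    intro ε hε
    have hev := ((tendsto_integral_norm_translate_sub hW).eventually_le_const hε).and
      ((tendsto_integral_norm_translate_sub hZ).eventually_le_const hε)
    obtain ⟨r, hr, hrε⟩ := Metric.nhds_basis_closedBall.eventually_iff.1 hev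
    obtain ⟨κ, hκ⟩ := exists_isMollifier (0 : Space n) (lt_min hr hρ₀)
    have hball : ∀ y ∈ Metric.closedBall (0 : Space n) (min r ρ₀), y ∈ Metric.closedBall 0 r :=
      fun y hy => Metric.closedBall_subset_closedBall (min_le_left _ _) hy
    have aW := hκ.integral_norm_convolution_sub_le hW fun y hy => (hrε (hball y hy)).1
    have aZ := hκ.integral_norm_convolution_sub_le hZ fun y hy => (hrε (hball y hy)).2
    have cW : ContDiff ℝ 1 (κ ⋆[ContinuousLinearMap.lsmul ℝ ℝ] W) := hκ.contDiff_convolution hW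
    have cZ : ContDiff ℝ 1 (κ ⋆[ContinuousLinearMap.lsmul ℝ ℝ] Z) := hκ.contDiff_convolution hZ
    have iW := ((hκ.integrable_convolution hW).sub hW).norm
    have iZ := ((hκ.integrable_convolution hZ).sub hZ).norm
    simp only [Pi.sub_apply] at iW iZ
    obtain ⟨P, hP, Q, hQ, hPs, hQs, hPQ⟩ := exists_fields_of_smooth_min_max cW cZ hε h₁ h₂
    have hthick : ∀ {p : Space n → Space n}, tsupport p ⊆ tsupport p₁ ∪ tsupport p₂ →
        Metric.cthickening (min r ρ₀) (tsupport p) ⊆ Ω := fun hp =>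
      ((Metric.cthickening_mono (min_le_right _ _) _).trans
        (Metric.cthickening_subset_of_subset _ hp)).trans hρΩ
    have bW := hwa.integral_convolution_mul_divergence_le hΩ.measurableSet hw hκ hP (hthick hPs)
    have bZ := hzb.integral_convolution_mul_divergence_le hΩ.measurableSet hz hκ hQ (hthick hQs)
    have hE : ∫ x, (‖(κ ⋆[ContinuousLinearMap.lsmul ℝ ℝ] W) x - W x‖ +
        ‖(κ ⋆[ContinuousLinearMap.lsmul ℝ ℝ] Z) x - Z x‖) ≤ 2 * ε := by
      rw [integral_add iW iZ]; linarith
    have hr' : Continuous fun x => √(((κ ⋆[ContinuousLinearMap.lsmul ℝ ℝ] W) x -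
        (κ ⋆[ContinuousLinearMap.lsmul ℝ ℝ] Z) x) ^ 2 + ε ^ 2) :=
      (((cW.continuous.sub cZ.continuous).pow 2).add continuous_const).sqrt
    have s1 := integral_mul_divergence_le_of_approx h₁.1 h₁.2.1 hB₁ (hW.inf hZ)
      (((cW.continuous.add cZ.continuous).sub hr').div_const 2) (iW.add iZ)
      (fun x => (abs_min_max_sub_smooth_le (W x) (Z x) _ _ hε.le).1)
      (fun x => add_nonneg (norm_nonneg _) (norm_nonneg _)) hE
    have s2 := integral_mul_divergence_le_of_approx h₂.1 h₂.2.1 hB₂ (hW.sup hZ)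
      (((cW.continuous.add cZ.continuous).add hr').div_const 2) (iW.add iZ)
      (fun x => (abs_min_max_sub_smooth_le (W x) (Z x) _ _ hε.le).2)
      (fun x => add_nonneg (norm_nonneg _) (norm_nonneg _)) hE
    have t1 : ∫ x, (W ⊓ Z) x * divergence p₁ x = ∫ x, min (W x) (Z x) * divergence p₁ x := rfl
    have t2 : ∫ x, (W ⊔ Z) x * divergence p₂ x = ∫ x, max (W x) (Z x) * divergence p₂ x := rfl
    rw [t1] at s1
    rw [t2] at s2
    simp only [Pi.add_apply, Pi.sub_apply] at s1 s2
    rw [hA, add_mul]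
    linarith
  have hlim : Tendsto (fun ε : ℝ => a + b + A * ε) (𝓝[>] 0) (𝓝 (a + b)) := by
    have : Tendsto (fun ε : ℝ => a + b + A * ε) (𝓝 0) (𝓝 (a + b + A * 0)) :=
      (continuous_const.add (continuous_const.mul continuous_id)).tendsto 0
    rw [mul_zero, add_zero] at this
    exact this.mono_left nhdsWithin_le_nhds
  exact ge_of_tendsto hlim (eventually_mem_nhdsWithin.mono fun ε hε => main ε hε)

/-- Submodularity of the total variation, `|D min(w, z)| + |D max(w, z)| ≤ |Dw| + |Dz|`. -/
theorem TVLe.exists_min_max {n : ℕ} {Ω : Set (Space n)} (hΩ : IsOpen Ω)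
    {w z : Space n → ℝ} {a b : ℝ} (hw : IntegrableOn w Ω) (hz : IntegrableOn z Ω)
    (hwa : TVLe Ω w a) (hzb : TVLe Ω z b) :
    ∃ c d, c + d = a + b ∧ TVLe Ω (fun x => min (w x) (z x)) c ∧
      TVLe Ω (fun x => max (w x) (z x)) d := by
  have key := fun {p₁ p₂} (h₁ : p₁ ∈ tvFields Ω) (h₂ : p₂ ∈ tvFields Ω) =>
    TVLe.integral_min_add_integral_max_le hΩ hw hz hwa hzb h₁ h₂
  let f : tvFields Ω → ℝ := fun p => ∫ x in Ω, min (w x) (z x) * divergence p.1 x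
  have hne : Nonempty (tvFields Ω) := ⟨⟨_, zero_mem_tvFields Ω⟩⟩
  have hle : ∀ {p₂}, p₂ ∈ tvFields Ω →
      ∀ p, f p ≤ a + b - ∫ x in Ω, max (w x) (z x) * divergence p₂ x :=
    fun h₂ p => by linarith [key p.2 h₂]
  have hbdd : BddAbove (range f) := ⟨_, forall_mem_range.2 (hle (zero_mem_tvFields Ω))⟩
  refine ⟨⨆ p, f p, a + b - ⨆ p, f p, by ring, fun p hp => le_ciSup hbdd ⟨p, hp⟩, fun p hp => ?_⟩
  linarith [ciSup_le (hle hp)]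

/-! ### Relaxation of the binary problem -/

/-- The functional `|Dw|(Ω) + ∫_Ω g w` is at most `M`. -/
def EnergyLe {n : ℕ} (Ω : Set (Space n)) (g w : Space n → ℝ) (M : ℝ) : Prop :=
  TVLe Ω w (M - ∫ x in Ω, g x * w x)

/-- Measurable functions on `Ω` with values in `[0, 1]`; the bounds are required at every point. -/
structure IsUnitValued {n : ℕ} (Ω : Set (Space n)) (w : Space n → ℝ) : Prop where
  aestronglyMeasurable : AEStronglyMeasurable w (volume.restrict Ω)
  nonneg : ∀ x, 0 ≤ w x
  le_one : ∀ x, w x ≤ 1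

namespace IsUnitValued

variable {n : ℕ} {Ω : Set (Space n)} {g w z : Space n → ℝ}

theorem abs_le (hw : IsUnitValued Ω w) (x : Space n) : |w x| ≤ 1 :=
  _root_.abs_le.2 ⟨by linarith [hw.nonneg x], hw.le_one x⟩

theorem integrableOn (hw : IsUnitValued Ω w) (hfin : volume Ω ≠ ⊤) : IntegrableOn w Ω := by
  have : IsFiniteMeasure (volume.restrict Ω) := ⟨by simpa using hfin.lt_top⟩
  exact (integrable_const (1 : ℝ)).mono' hw.aestronglyMeasurable (Eventually.of_forall hw.abs_le)

theorem integrableOn_mul (hw : IsUnitValued Ω w) (hg : IntegrableOn g Ω) :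
    IntegrableOn (fun x => g x * w x) Ω :=
  Integrable.mul_bdd hg hw.aestronglyMeasurable (Eventually.of_forall hw.abs_le)

theorem min (hw : IsUnitValued Ω w) (hz : IsUnitValued Ω z) :
    IsUnitValued Ω (fun x => min (w x) (z x)) :=
  ⟨hw.1.inf hz.1, fun x => le_min (hw.2 x) (hz.2 x), fun x => (min_le_left _ _).trans (hw.3 x)⟩

theorem max (hw : IsUnitValued Ω w) (hz : IsUnitValued Ω z) :
    IsUnitValued Ω (fun x => max (w x) (z x)) :=
  ⟨hw.1.sup hz.1, fun x => (hw.2 x).trans (le_max_left _ _), fun x => max_le (hw.3 x) (hz.3 x)⟩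

theorem comp {f : ℝ → ℝ} (hf : Measurable f) (hf0 : ∀ t, 0 ≤ f t) (hf1 : ∀ t, f t ≤ 1)
    (hw : AEStronglyMeasurable w (volume.restrict Ω)) : IsUnitValued Ω (fun x => f (w x)) :=
  ⟨(hf.comp_aemeasurable hw.aemeasurable).aestronglyMeasurable, fun _ => hf0 _, fun _ => hf1 _⟩

theorem half (hw : IsUnitValued Ω w) : IsUnitValued Ω (fun x => 1 / 2 * w x) :=
  ⟨hw.1.const_mul _, fun x => by linarith [hw.2 x], fun x => by linarith [hw.3 x]⟩

theorem half_add_half (hw : IsUnitValued Ω w) :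
    IsUnitValued Ω (fun x => 1 / 2 * w x + 1 / 2) :=
  ⟨(hw.1.const_mul _).add_const _, fun x => by linarith [hw.2 x], fun x => by linarith [hw.3 x]⟩

end IsUnitValued

namespace EnergyLe

variable {n : ℕ} {Ω : Set (Space n)} {g w z : Space n → ℝ} {M K a b : ℝ}

theorem mono (h : EnergyLe Ω g w M) (hMK : M ≤ K) : EnergyLe Ω g w K :=
  TVLe.mono h (by linarith)

theorem affine (hg : IntegrableOn g Ω) (hw : IntegrableOn w Ω)
    (hgw : IntegrableOn (fun x => g x * w x) Ω) (h : EnergyLe Ω g w M) (ha : 0 ≤ a) (b : ℝ) :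
    EnergyLe Ω g (fun x => a * w x + b) (a * M + b * ∫ x in Ω, g x) := by
  refine (TVLe.affine h hw ha b).mono (le_of_eq ?_)
  have : ∀ x, g x * (a * w x + b) = a * (g x * w x) + b * g x := fun x => by ring
  simp only [this]
  rw [integral_add (hgw.const_mul a) (hg.const_mul b), integral_const_mul, integral_const_mul]
  ring

theorem exists_min_max (hΩ : IsOpen Ω) (hfin : volume Ω ≠ ⊤) (hg : IntegrableOn g Ω)
    (hw : IsUnitValued Ω w) (hz : IsUnitValued Ω z)
    (h : EnergyLe Ω g w M) (h' : EnergyLe Ω g z K) :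
    ∃ a b, a + b = M + K ∧ EnergyLe Ω g (fun x => min (w x) (z x)) a ∧
      EnergyLe Ω g (fun x => max (w x) (z x)) b := by
  obtain ⟨c, d, hcd, hc, hd⟩ :=
    TVLe.exists_min_max hΩ (hw.integrableOn hfin) (hz.integrableOn hfin) h h'
  refine ⟨c + ∫ x in Ω, g x * min (w x) (z x), d + ∫ x in Ω, g x * max (w x) (z x), ?_,
    TVLe.mono hc (by linarith), TVLe.mono hd (by linarith)⟩
  have e1 := integral_add ((hw.min hz).integrableOn_mul hg) ((hw.max hz).integrableOn_mul hg)
  have e2 := integral_add (hw.integrableOn_mul hg) (hz.integrableOn_mul hg)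
  simp only [← mul_add, min_add_max] at e1 e2
  linarith

/-- Lowering `w` to `min w z` does not increase the energy, if `max w z` does not beat `z`. -/
theorem min_of_le (hΩ : IsOpen Ω) (hfin : volume Ω ≠ ⊤) (hg : IntegrableOn g Ω)
    (hw : IsUnitValued Ω w) (hz : IsUnitValued Ω z)
    (h : EnergyLe Ω g w M) (h' : EnergyLe Ω g z K)
    (hK : ∀ b, EnergyLe Ω g (fun x => max (w x) (z x)) b → K ≤ b) :
    EnergyLe Ω g (fun x => min (w x) (z x)) M := by
  obtain ⟨a, b, hab, ha, hb⟩ := exists_min_max hΩ hfin hg hw hz h h'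
  exact ha.mono (by linarith [hK b hb])

/-- Raising `w` to `max w z` does not increase the energy, if `min w z` does not beat `z`. -/
theorem max_of_le (hΩ : IsOpen Ω) (hfin : volume Ω ≠ ⊤) (hg : IntegrableOn g Ω)
    (hw : IsUnitValued Ω w) (hz : IsUnitValued Ω z)
    (h : EnergyLe Ω g w M) (h' : EnergyLe Ω g z K)
    (hK : ∀ a, EnergyLe Ω g (fun x => min (w x) (z x)) a → K ≤ a) :
    EnergyLe Ω g (fun x => max (w x) (z x)) M := by
  obtain ⟨a, b, hab, ha, hb⟩ := exists_min_max hΩ hfin hg hw hz h h'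
  exact hb.mono (by linarith [hK a ha])

/-- Cutting `w` at the level `s` writes it as the convex combination
`s • min (w / s) 1 + (1 - s) • max ((w - s) / (1 - s)) 0`. By submodularity the energies of the
pieces, weighted alike, sum to at most the energy of `w`, so that one piece has no larger energy. -/
theorem split (hΩ : IsOpen Ω) (hfin : volume Ω ≠ ⊤) (hg : IntegrableOn g Ω)
    (hw : IsUnitValued Ω w) (h : EnergyLe Ω g w M) {s : ℝ} (hs0 : 0 < s) (hs1 : s < 1) :
    EnergyLe Ω g (fun x => min (w x / s) 1) M ∨
      EnergyLe Ω g (fun x => max ((w x - s) / (1 - s)) 0) M := by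
  have hc : IsUnitValued Ω (fun _ : Space n => s) :=
    ⟨aestronglyMeasurable_const, fun _ => hs0.le, fun _ => hs1.le⟩
  have hsE : EnergyLe Ω g (fun _ => s) (s * ∫ x in Ω, g x) := by
    refine TVLe.mono (TVLe.const Ω s) (le_of_eq ?_)
    rw [integral_mul_const]; ring
  have hs1' : 0 < 1 - s := by linarith
  obtain ⟨a, b, hab, ha, hb⟩ := exists_min_max hΩ hfin hg hw hc h hsE
  have ha' := affine hg ((hw.min hc).integrableOn hfin) ((hw.min hc).integrableOn_mul hg) ha
    (inv_nonneg.2 hs0.le) 0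
  have hb' := affine hg ((hw.max hc).integrableOn hfin) ((hw.max hc).integrableOn_mul hg) hb
    (inv_nonneg.2 hs1'.le) (-(s / (1 - s)))
  have e1 : (fun x => s⁻¹ * min (w x) s + 0) = fun x => min (w x / s) 1 := by
    ext x
    rw [add_zero, mul_min_of_nonneg _ _ (inv_nonneg.2 hs0.le), inv_mul_cancel₀ hs0.ne',
      inv_mul_eq_div]
  have e2 : (fun x => (1 - s)⁻¹ * max (w x) s + -(s / (1 - s))) =
      fun x => max ((w x - s) / (1 - s)) 0 := by
    ext x
    rw [mul_max_of_nonneg _ _ (inv_nonneg.2 hs1'.le), max_add, inv_mul_eq_div, inv_mul_eq_div]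
    congr 1 <;> ring
  rw [e1] at ha'
  rw [e2] at hb'
  by_cases hM : s⁻¹ * a ≤ M
  · exact Or.inl (ha'.mono (by linarith))
  · refine Or.inr (hb'.mono ?_)
    rw [not_le, inv_mul_eq_div, lt_div_iff₀ hs0] at hM
    have : (1 - s)⁻¹ * b + -(s / (1 - s)) * ∫ x in Ω, g x =
        (b - s * ∫ x in Ω, g x) / (1 - s) := by ring
    rw [this, div_le_iff₀ hs1']
    linarith

/-- Repeated cutting at the level `1/2` yields ever steeper truncations of `w` with at most its
energy. -/
theorem exists_steep (hΩ : IsOpen Ω) (hfin : volume Ω ≠ ⊤) (hg : IntegrableOn g Ω)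
    (hw : IsUnitValued Ω w) (h : EnergyLe Ω g w M) (k : ℕ) :
    ∃ j : ℝ, 0 ≤ j ∧ j ≤ 2 ^ k - 1 ∧
      EnergyLe Ω g (fun x => max 0 (min 1 (2 ^ k * w x - j))) M := by
  induction k with
  | zero =>
    refine ⟨0, le_rfl, by norm_num, ?_⟩
    have : (fun x => max 0 (min 1 (2 ^ 0 * w x - 0))) = w := by
      ext x
      simp [hw.le_one x, hw.nonneg x]
    rwa [this]
  | succ k ih =>
    obtain ⟨j, hj0, hj1, hj⟩ := ih
    have hu : IsUnitValued Ω (fun x => max 0 (min 1 (2 ^ k * w x - j))) :=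
      IsUnitValued.comp (f := fun t => max 0 (min 1 (2 ^ k * t - j))) (by fun_prop)
        (fun _ => le_max_left _ _) (fun _ => max_le zero_le_one (min_le_left _ _)) hw.1
    rcases split hΩ hfin hg hu hj (s := 1 / 2) (by norm_num) (by norm_num) with h | h
    · refine ⟨2 * j, by linarith, by rw [pow_succ]; linarith, ?_⟩
      have : (fun x => max 0 (min 1 (2 ^ (k + 1) * w x - 2 * j))) =
          fun x => min (max 0 (min 1 (2 ^ k * w x - j)) / (1 / 2)) 1 := by
        ext x
        rw [pow_succ]
        grind
      rwa [this]
    · refine ⟨2 * j + 1, by linarith, by rw [pow_succ]; linarith, ?_⟩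
      have : (fun x => max 0 (min 1 (2 ^ (k + 1) * w x - (2 * j + 1)))) =
          fun x => max ((max 0 (min 1 (2 ^ k * w x - j)) - 1 / 2) / (1 - 1 / 2)) 0 := by
        ext x
        rw [pow_succ]
        grind
      rwa [this]

/-- Lower semicontinuity of the energy. -/
theorem of_tendsto (hg : IntegrableOn g Ω) {u : ℕ → Space n → ℝ}
    (hu : ∀ k, IsUnitValued Ω (u k)) (hlim : ∀ x, Tendsto (fun k => u k x) atTop (𝓝 (w x)))
    (h : ∀ k, EnergyLe Ω g (u k) M) : EnergyLe Ω g w M := by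
  refine TVLe.of_tendsto (fun k => (hu k).1) (fun k => (hu k).abs_le) hlim ?_ h
  refine tendsto_const_nhds.sub (tendsto_integral_of_dominated_convergence (fun x => ‖g x‖)
    (fun k => ((hu k).integrableOn_mul hg).aestronglyMeasurable) hg.norm
    (fun k => Eventually.of_forall fun x => ?_)
    (Eventually.of_forall fun x => (hlim x).const_mul _))
  rw [norm_mul]
  exact mul_le_of_le_one_right (norm_nonneg _) ((hu k).abs_le x)

/-- A `[0, 1]`-valued function can be replaced by a `{0, 1}`-valued one without increasing the
energy: a limit of ever steeper cuts takes the values `0` and `1`, and a constant `a` on one level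
set `{w = s}`, and a last cut at the level `a` removes this value. -/
theorem exists_binary (hΩ : IsOpen Ω) (hfin : volume Ω ≠ ⊤) (hg : IntegrableOn g Ω)
    (hw : IsUnitValued Ω w) (h : EnergyLe Ω g w M) :
    ∃ z, IsUnitValued Ω z ∧ (∀ x, z x = 0 ∨ z x = 1) ∧ EnergyLe Ω g z M := by
  choose j hj0 hj1 hj using exists_steep hΩ hfin hg hw h
  have hpow : ∀ k : ℕ, (0 : ℝ) < 2 ^ k := fun k => by positivity
  obtain ⟨s, -, φ, hφ, hs⟩ := isCompact_Icc.tendsto_subseq (s := Icc (0 : ℝ) 1)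
    (x := fun k => j k / 2 ^ k) fun k =>
      ⟨div_nonneg (hj0 k) (hpow k).le, (div_le_one (hpow k)).2 (by linarith [hj1 k])⟩
  -- the truncations cut a band of width `2⁻ᵏ` above `j k / 2 ^ k → s`;
  -- on `{w = s}` they are constant
  let T : ℕ → ℝ → ℝ := fun k t => max 0 (min 1 (2 ^ k * t - j k))
  have hT0 : ∀ k t, 0 ≤ T k t := fun _ _ => le_max_left _ _
  have hT1 : ∀ k t, T k t ≤ 1 := fun _ _ => max_le zero_le_one (min_le_left _ _)
  obtain ⟨a, ⟨ha0, ha1⟩, ψ, hψ, ha⟩ := isCompact_Icc.tendsto_subseq (s := Icc (0 : ℝ) 1)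
    (x := fun k => T (φ k) s) fun k => ⟨hT0 _ _, hT1 _ _⟩
  let θ : ℕ → ℕ := fun k => φ (ψ k)
  have hθ : Tendsto θ atTop atTop := hφ.tendsto_atTop.comp hψ.tendsto_atTop
  have hs' : Tendsto (fun k => j (θ k) / 2 ^ (θ k)) atTop (𝓝 s) := hs.comp hψ.tendsto_atTop
  have h2 : Tendsto (fun k => (2 : ℝ) ^ (θ k)) atTop atTop :=
    (tendsto_pow_atTop_atTop_of_one_lt one_lt_two).comp hθ
  have hfac : ∀ t k, 2 ^ (θ k) * t - j (θ k) = (t - j (θ k) / 2 ^ (θ k)) * 2 ^ (θ k) := by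
    intro t k
    have := (hpow (θ k)).ne'
    field_simp
  have hlim : ∀ t, Tendsto (fun k => T (θ k) t) atTop
      (𝓝 (if s < t then 1 else if t = s then a else 0)) := by
    intro t
    have hd : Tendsto (fun k => t - j (θ k) / 2 ^ (θ k)) atTop (𝓝 (t - s)) :=
      tendsto_const_nhds.sub hs'
    rcases lt_trichotomy s t with hst | rfl | hst
    · rw [if_pos hst]
      have := hd.pos_mul_atTop (sub_pos.2 hst) h2
      refine tendsto_const_nhds.congr' ?_
      filter_upwards [this.eventually_ge_atTop 1] with k hk
      simp only [T, hfac]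
      rw [min_eq_left hk, max_eq_right zero_le_one]
    · rw [if_neg (lt_irrefl _), if_pos rfl]
      exact ha
    · rw [if_neg hst.not_gt, if_neg hst.ne]
      have := hd.neg_mul_atTop (sub_neg.2 hst) h2
      refine tendsto_const_nhds.congr' ?_
      filter_upwards [this.eventually_le_atBot 0] with k hk
      simp only [T, hfac]
      rw [min_eq_right (hk.trans zero_le_one), max_eq_left hk]
  have hstep : ∀ c : ℝ, 0 ≤ c → c ≤ 1 →
      IsUnitValued Ω (fun x => if s < w x then 1 else if w x = s then c else 0) := fun c hc0 hc1 =>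
    IsUnitValued.comp (f := fun t => if s < t then 1 else if t = s then c else 0)
      (Measurable.ite measurableSet_Ioi measurable_const
        (Measurable.ite (measurableSet_singleton s) measurable_const measurable_const))
      (fun t => by split_ifs <;> simp [hc0]) (fun t => by split_ifs <;> simp [hc1]) hw.1
  have hz : EnergyLe Ω g (fun x => if s < w x then 1 else if w x = s then a else 0) M :=
    of_tendsto hg (fun k => IsUnitValued.comp (f := T (θ k)) (by fun_prop) (hT0 _) (hT1 _) hw.1)
      (fun x => hlim (w x)) (fun k => hj (θ k))
  have hbin : ∀ c : ℝ, c = 0 ∨ c = 1 →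
      EnergyLe Ω g (fun x => if s < w x then 1 else if w x = s then c else 0) M →
      ∃ z, IsUnitValued Ω z ∧ (∀ x, z x = 0 ∨ z x = 1) ∧ EnergyLe Ω g z M := by
    intro c hc hE
    refine ⟨_, hstep c ?_ ?_, fun x => ?_, hE⟩
    · rcases hc with rfl | rfl <;> norm_num
    · rcases hc with rfl | rfl <;> norm_num
    · split_ifs <;> simp [hc]
  rcases ha0.eq_or_lt with rfl | ha0
  · exact hbin 0 (Or.inl rfl) hz
  rcases ha1.eq_or_lt with rfl | ha1
  · exact hbin 1 (Or.inr rfl) hz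
  rcases split hΩ hfin hg (hstep a ha0.le ha1.le) hz ha0 ha1 with h | h
  · refine hbin 1 (Or.inr rfl) ?_
    convert h using 2 with x
    split_ifs
    · rw [min_eq_right ((one_le_div ha0).2 ha1.le)]
    · rw [div_self ha0.ne', min_self]
    · simp
  · refine hbin 0 (Or.inl rfl) ?_
    convert h using 2 with x
    split_ifs
    · rw [div_self (by linarith), max_eq_left zero_le_one]
    · simp
    · rw [max_eq_right (div_nonpos_of_nonpos_of_nonneg (by linarith) (by linarith))]

/-- If `χ` minimizes the energy among `{0, 1}`-valued functions, then raising a `[0, 1]`-valued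
`v` to at least `1/2` on `{χ = 1}` and lowering it to at most `1/2` on `{χ = 0}` does not increase
the energy. -/
theorem rearrange (hΩ : IsOpen Ω) (hfin : volume Ω ≠ ⊤) (hg : IntegrableOn g Ω)
    {χ v : Space n → ℝ} {m : ℝ} (hχ : IsUnitValued Ω χ) (hχm : EnergyLe Ω g χ m)
    (hmin : ∀ z, IsUnitValued Ω z → (∀ x, z x = 0 ∨ z x = 1) → ∀ K, EnergyLe Ω g z K → m ≤ K)
    (hv : IsUnitValued Ω v) (hvM : EnergyLe Ω g v M) :
    EnergyLe Ω g (fun x => max (min (v x) (1 / 2 * χ x + 1 / 2)) (1 / 2 * χ x)) M := by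
  have hrel : ∀ z, IsUnitValued Ω z → ∀ K, EnergyLe Ω g z K → m ≤ K := fun z hz K hK => by
    obtain ⟨z', hz', hb, hE⟩ := exists_binary hΩ hfin hg hz hK
    exact hmin z' hz' hb K hE
  have aff : ∀ {z : Space n → ℝ} {K : ℝ}, IsUnitValued Ω z → EnergyLe Ω g z K →
      ∀ {a : ℝ}, 0 ≤ a → ∀ b, EnergyLe Ω g (fun x => a * z x + b) (a * K + b * ∫ x in Ω, g x) :=
    fun hz hK _ ha b => affine hg (hz.integrableOn hfin) (hz.integrableOn_mul hg) hK ha b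
  have hup := hχ.half_add_half
  have hlo := hχ.half
  have hhalf : (0 : ℝ) ≤ 1 / 2 := by norm_num
  have hElo : EnergyLe Ω g (fun x => 1 / 2 * χ x) (1 / 2 * m) := by
    simpa using aff hχ hχm hhalf 0
  refine max_of_le hΩ hfin hg (hv.min hup) hlo
    (min_of_le hΩ hfin hg hv hup hvM (aff hχ hχm hhalf (1 / 2)) fun b hb => ?_) hElo fun a ha => ?_
  -- `max v (χ / 2 + 1 / 2)` has values in `[1/2, 1]`; rescaled to `[0, 1]` it competes with `χ`
  · have hX := hv.max hup
    have := hrel (fun x => 2 * max (v x) (1 / 2 * χ x + 1 / 2) + -1)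
      ⟨(hX.1.const_mul _).add_const _, fun x => ?_, fun x => by linarith [hX.3 x]⟩ _
      (aff hX hb zero_le_two (-1))
    · linarith
    · linarith [le_max_right (v x) (1 / 2 * χ x + 1 / 2), hχ.2 x]
  -- the minimum has values in `[0, 1/2]`; rescaled to `[0, 1]` it competes with `χ`
  · have hY := (hv.min hup).min hlo
    have := hrel (fun x => 2 * min (min (v x) (1 / 2 * χ x + 1 / 2)) (1 / 2 * χ x) + 0)
      ⟨(hY.1.const_mul _).add_const _, fun x => by linarith [hY.2 x], fun x => ?_⟩ _
      (aff hY ha zero_le_two 0)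
    · linarith
    · linarith [min_le_right (min (v x) (1 / 2 * χ x + 1 / 2)) (1 / 2 * χ x), hχ.3 x]

end EnergyLe

/-! ### Weak duality on Lipschitz domains -/

/-- Near a point of its closure, a Lipschitz domain is mapped into itself by all translations in a
cone around a fixed direction `e` (`e = 0` at interior points). -/
theorem IsBoundedLipschitz.exists_inward {n : ℕ} {Ω : Set (Space n)} (hΩ : IsBoundedLipschitz Ω)
    {x : Space n} (hx : x ∈ closure Ω) :
    ∃ r > 0, ∃ e : Space n, ‖e‖ ≤ 1 ∧ ∃ c > 0, c ≤ 1 ∧ ∀ᶠ t : ℝ in 𝓝[>] 0,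
      ∀ z ∈ Metric.ball x r ∩ closure Ω, ∀ y ∈ Metric.closedBall (t • e) (c * t), z + y ∈ Ω := by
  obtain ⟨ho, -, hL⟩ := hΩ
  have hsmall : ∀ r : ℝ, 0 < r → ∀ᶠ t : ℝ in 𝓝[>] 0, 0 < t ∧ t < r := fun r hr =>
    Ioo_mem_nhdsGT hr
  have hy2 : ∀ {t c : ℝ} {e y : Space n}, 0 < t → ‖e‖ ≤ 1 → c ≤ 1 →
      y ∈ Metric.closedBall (t • e) (c * t) → ‖y‖ ≤ 2 * t := by
    intro t c e y ht he hc hy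
    rw [mem_closedBall_iff_norm] at hy
    have h1 : ‖y‖ ≤ ‖y - t • e‖ + ‖t • e‖ := by simpa using norm_add_le (y - t • e) (t • e)
    rw [norm_smul, Real.norm_of_nonneg ht.le] at h1
    nlinarith
  by_cases hxΩ : x ∈ Ω
  · obtain ⟨r, hr, hrΩ⟩ := Metric.isOpen_iff.1 ho x hxΩ
    refine ⟨r / 2, by positivity, 0, by simp, 1, one_pos, le_rfl, ?_⟩
    filter_upwards [hsmall (r / 4) (by positivity)] with t ⟨ht, htr⟩ z hz y hy
    have := hy2 ht (by simp) le_rfl hy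
    refine hrΩ ?_
    have hz1 := mem_ball_iff_norm.1 hz.1
    rw [mem_ball_iff_norm, add_sub_right_comm]
    exact (norm_add_le _ _).trans_lt (by linarith)
  · obtain ⟨U, hU, hxU, e, he, K, γ, hγ, hUΩ⟩ := hL x ⟨hx, by rwa [ho.interior_eq]⟩
    obtain ⟨r, hr, hrU⟩ := Metric.isOpen_iff.1 hU x hxU
    have hK : (0 : ℝ) < 2 * (1 + K) := by positivity
    have hc1 : 1 / (2 * (1 + (K : ℝ))) ≤ 1 := by
      rw [div_le_one hK]; linarith [K.coe_nonneg]
    refine ⟨r / 2, by positivity, e, he.le, 1 / (2 * (1 + K)), by positivity, hc1, ?_⟩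
    filter_upwards [hsmall (r / 4) (by positivity)] with t ⟨ht, htr⟩ z hz y hy
    have hy' := hy2 ht he.le hc1 hy
    have hz1 := mem_ball_iff_norm.1 hz.1
    have hzyU : z + y ∈ U := hrU (by
      rw [mem_ball_iff_norm, add_sub_right_comm]
      exact (norm_add_le _ _).trans_lt (by linarith))
    have hzU : z ∈ U := hrU (by rw [mem_ball_iff_norm]; linarith)
    -- the closed epigraph inequality holds at `z`
    have hzle : γ (z - inner ℝ e z • e) ≤ inner ℝ e z := by
      have hcl : IsClosed {y : Space n | γ (y - inner ℝ e y • e) ≤ inner ℝ e y} :=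
        isClosed_le (hγ.continuous.comp (by fun_prop)) (by fun_prop)
      have hzcl : z ∈ closure (U ∩ Ω) := hU.inter_closure ⟨hzU, hz.2⟩
      exact (closure_minimal (fun y hy => ((hUΩ y hy.1).1 hy.2).le) hcl) hzcl
    rw [hUΩ _ hzyU]
    set s := y - t • e with hs
    have hsn : ‖s‖ ≤ 1 / (2 * (1 + K)) * t := mem_closedBall_iff_norm.1 hy
    have hyeq : y = t • e + s := by rw [hs]; abel
    have hee : inner ℝ e e = 1 := by rw [real_inner_self_eq_norm_sq, he, one_pow]
    have hin : inner ℝ e (z + y) = inner ℝ e z + t + inner ℝ e s := by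
      rw [hyeq, inner_add_right, inner_add_right, inner_smul_right, hee]; ring
    have hpos : -‖s‖ ≤ inner ℝ e s := by
      have := abs_real_inner_le_norm e s
      rw [he, one_mul] at this
      exact (abs_le.1 this).1
    have hproj : ‖s - inner ℝ e s • e‖ ≤ ‖s‖ := by
      have h : ‖s - inner ℝ e s • e‖ ^ 2 = ‖s‖ ^ 2 - (inner ℝ e s) ^ 2 := by
        rw [norm_sub_sq_real, norm_smul, inner_smul_right, real_inner_comm, he, mul_one,
          Real.norm_eq_abs, sq_abs]
        ring
      refine (sq_le_sq₀ (norm_nonneg _) (norm_nonneg _)).1 ?_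
      rw [h]
      linarith [sq_nonneg (inner ℝ e s : ℝ)]
    have hlip : γ (z + y - inner ℝ e (z + y) • e) ≤ γ (z - inner ℝ e z • e) + K * ‖s‖ := by
      have h1 := hγ.dist_le_mul (z + y - inner ℝ e (z + y) • e) (z - inner ℝ e z • e)
      have h2 : z + y - inner ℝ e (z + y) • e - (z - inner ℝ e z • e) = s - inner ℝ e s • e := by
        rw [hin, hyeq, add_smul, add_smul]; abel
      rw [Real.dist_eq, dist_eq_norm, h2] at h1
      have h3 := mul_le_mul_of_nonneg_left hproj K.coe_nonneg
      linarith [le_abs_self (γ (z + y - inner ℝ e (z + y) • e) - γ (z - inner ℝ e z • e))]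
    have hfin : (1 + K) * ‖s‖ ≤ t / 2 := by
      calc (1 + K) * ‖s‖ ≤ (1 + K) * (1 / (2 * (1 + K)) * t) := by gcongr
        _ = t / 2 := by field_simp
    linarith

open scoped Manifold in
/-- A smooth partition of unity on the closure of a Lipschitz domain, each member of which has a
cone of admissible inward translations on its support. -/
theorem IsBoundedLipschitz.exists_partition {n : ℕ} {Ω : Set (Space n)}
    (hΩ : IsBoundedLipschitz Ω) :
    ∃ (ι : Finset (Space n)) (ζ : ι → Space n → ℝ) (e : ι → Space n) (c : ι → ℝ),
      (∀ i, ContDiff ℝ ∞ (ζ i)) ∧ (∀ i, HasCompactSupport (ζ i)) ∧ (∀ i x, 0 ≤ ζ i x) ∧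
      (∀ x, ∑ i, ζ i x ≤ 1) ∧ (∀ x ∈ closure Ω, ∑ i, ζ i x = 1) ∧ (∀ i, ‖e i‖ ≤ 1) ∧
      (∀ i, 0 < c i) ∧ (∀ i, c i ≤ 1) ∧
      ∀ i, ∀ᶠ t : ℝ in 𝓝[>] 0, ∀ z ∈ tsupport (ζ i) ∩ closure Ω,
        ∀ y ∈ Metric.closedBall (t • e i) (c i * t), z + y ∈ Ω := by
  choose! r hr e he c hc hc1 hcone using fun x (hx : x ∈ closure Ω) => hΩ.exists_inward hx
  obtain ⟨ι, hι, hcov⟩ := hΩ.2.1.isCompact_closure.elim_nhds_subcover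
    (fun x => Metric.ball x (r x)) fun x hx => Metric.ball_mem_nhds x (hr x hx)
  obtain ⟨f, hf⟩ := SmoothPartitionOfUnity.exists_isSubordinate 𝓘(ℝ, Space n)
    (isClosed_closure (s := Ω)) (fun i : ι => Metric.ball (i : Space n) (r i))
    (fun i => Metric.isOpen_ball) (fun x hx => by simpa using hcov hx)
  refine ⟨ι, fun i => f i, fun i => e i, fun i => c i, fun i => (f i).contMDiff.contDiff,
    fun i => ?_, fun i => f.nonneg i, fun x => ?_, fun x hx => ?_, fun i => he _ (hι _ i.2),
    fun i => hc _ (hι _ i.2), fun i => hc1 _ (hι _ i.2), fun i => ?_⟩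
  · exact (isCompact_closedBall (i : Space n) (r i)).of_isClosed_subset (isClosed_tsupport _)
      ((hf i).trans Metric.ball_subset_closedBall)
  · rw [← finsum_eq_sum_of_fintype]; exact f.sum_le_one x
  · rw [← finsum_eq_sum_of_fintype]; exact f.sum_eq_one hx
  · filter_upwards [hcone _ (hι _ i.2)] with t ht z hz y hy
    exact ht z ⟨hf i hz.1, hz.2⟩ y hy

theorem IsMollifier.norm_convolution_le {n : ℕ} {κ : Space n → ℝ} {z : Space n} {ρ : ℝ}
    (hκ : IsMollifier κ z ρ) {F : Space n → Space n} {x : Space n} {b : ℝ}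
    (hb : ∀ y ∈ Metric.closedBall z ρ, ‖F (x - y)‖ ≤ b) :
    ‖(κ ⋆[ContinuousLinearMap.lsmul ℝ ℝ] F) x‖ ≤ b := by
  have h : ‖(κ ⋆[ContinuousLinearMap.lsmul ℝ ℝ] F) x‖ ≤ ∫ y, κ y * b := by
    refine norm_integral_le_of_norm_le (hκ.integrable.mul_const b)
      (Eventually.of_forall fun y => ?_)
    rw [ContinuousLinearMap.lsmul_apply, norm_smul, Real.norm_of_nonneg (hκ.nonneg y)]
    by_cases hy : κ y = 0
    · simp [hy]
    · exact mul_le_mul_of_nonneg_left (hb y (hκ.mem_of_ne_zero hy)) (hκ.nonneg y)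
  rwa [integral_mul_const, hκ.integral_eq_one, one_mul] at h

/-- Localization of a weak divergence on `ℝⁿ` by the product rule. -/
theorem integral_fderiv_apply_smul {n : ℕ} {F : Space n → Space n} {f : Space n → ℝ}
    (hF : Integrable F) (hf : Integrable f)
    (hw : ∀ φ : Space n → ℝ, ContDiff ℝ ∞ φ → HasCompactSupport φ →
      ∫ x, fderiv ℝ φ x (F x) = - ∫ x, φ x * f x)
    {ζ : Space n → ℝ} (hζ : ContDiff ℝ ∞ ζ) (hζc : HasCompactSupport ζ)
    {φ : Space n → ℝ} (hφ : ContDiff ℝ ∞ φ) (hφc : HasCompactSupport φ) :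
    ∫ x, fderiv ℝ φ x (ζ x • F x) = - ∫ x, φ x * (ζ x * f x + fderiv ℝ ζ x (F x)) := by
  have hd : ∀ x, fderiv ℝ (fun x => φ x * ζ x) x (F x) =
      fderiv ℝ φ x (ζ x • F x) + φ x * fderiv ℝ ζ x (F x) := by
    intro x
    have h := ((hφ.differentiable (by simp) x).hasFDerivAt.mul
      (hζ.differentiable (by simp) x).hasFDerivAt).fderiv
    have h' : fderiv ℝ (fun x => φ x * ζ x) x = φ x • fderiv ℝ ζ x + ζ x • fderiv ℝ φ x := h
    rw [h']
    simp
    ring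
  have key := hw (fun x => φ x * ζ x) (hφ.mul hζ) hφc.mul_right
  have dφ : Continuous (fderiv ℝ φ) := hφ.continuous_fderiv (by simp)
  have dζ : Continuous (fderiv ℝ ζ) := hζ.continuous_fderiv (by simp)
  obtain ⟨A, hA⟩ := (hφc.fderiv (𝕜 := ℝ)).exists_bound_of_continuous dφ
  obtain ⟨B, hB⟩ := (hζc.fderiv (𝕜 := ℝ)).exists_bound_of_continuous dζ
  obtain ⟨a, ha⟩ := hφc.exists_bound_of_continuous hφ.continuous
  obtain ⟨b, hb⟩ := hζc.exists_bound_of_continuous hζ.continuous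
  have I1 : Integrable fun x => fderiv ℝ ζ x (F x) := by
    refine (hF.norm.const_mul B).mono' ?_ (Eventually.of_forall fun x =>
      ((fderiv ℝ ζ x).le_opNorm _).trans (mul_le_mul_of_nonneg_right (hB x) (norm_nonneg _)))
    exact (ContinuousLinearMap.id ℝ (Space n →L[ℝ] ℝ)).aestronglyMeasurable_comp₂
      dζ.aestronglyMeasurable hF.aestronglyMeasurable
  have I2 : Integrable fun x => ζ x • F x :=
    hF.bdd_smul b hζ.continuous.aestronglyMeasurable (Eventually.of_forall hb)
  have I3 : Integrable fun x => fderiv ℝ φ x (ζ x • F x) := by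
    refine (I2.norm.const_mul A).mono' ?_ (Eventually.of_forall fun x =>
      ((fderiv ℝ φ x).le_opNorm _).trans (mul_le_mul_of_nonneg_right (hA x) (norm_nonneg _)))
    exact (ContinuousLinearMap.id ℝ (Space n →L[ℝ] ℝ)).aestronglyMeasurable_comp₂
      dφ.aestronglyMeasurable I2.aestronglyMeasurable
  have I4 : Integrable fun x => φ x * fderiv ℝ ζ x (F x) :=
    I1.bdd_mul hφ.continuous.aestronglyMeasurable (Eventually.of_forall ha)
  have I5 : Integrable fun x => φ x * (ζ x * f x) :=
    (hf.bdd_mul hζ.continuous.aestronglyMeasurable (Eventually.of_forall hb)).bdd_mul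
      hφ.continuous.aestronglyMeasurable (Eventually.of_forall ha)
  simp only [hd] at key
  rw [integral_add I3 I4] at key
  simp only [mul_add]
  rw [integral_add I5 I4]
  simp only [mul_assoc] at key
  linarith

theorem eventually_forall_closedBall_smul {n : ℕ} {s : Set (Space n)} (hs : s ∈ 𝓝 (0 : Space n))
    {e : Space n} (he : ‖e‖ ≤ 1) {c : ℝ} (hc : c ≤ 1) :
    ∀ᶠ t : ℝ in 𝓝[>] 0, ∀ y ∈ Metric.closedBall (t • e) (c * t), y ∈ s := by
  obtain ⟨r, hr, hrs⟩ := Metric.mem_nhds_iff.1 hs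
  filter_upwards [Ioo_mem_nhdsGT (half_pos hr)] with t ⟨ht, htr⟩ y hy
  rw [mem_closedBall_iff_norm] at hy
  have h1 : ‖y‖ ≤ ‖y - t • e‖ + ‖t • e‖ := by simpa using norm_add_le (y - t • e) (t • e)
  rw [norm_smul, Real.norm_of_nonneg ht.le] at h1
  refine hrs (mem_ball_zero_iff.2 ?_)
  nlinarith

open scoped Pointwise in
/-- On a Lipschitz domain, a merely integrable field `q` with `|q| ≤ 1` whose extension by zero has
the weak divergence `d` on `ℝⁿ` may be used as a test field for the total variation. Each piece
`ζ i • q` of `q` is translated inwards and mollified; the sum of these smooth fields is compactly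
supported in `Ω`, exceeds the norm `1` by as little as desired, and its divergence converges to `d`
in `L¹`. -/
theorem TVLe.integral_mul_weak_divergence_le {n : ℕ} {Ω : Set (Space n)}
    (hΩ : IsBoundedLipschitz Ω) {w : Space n → ℝ} {C : ℝ} (h : TVLe Ω w C)
    (hw : IsUnitValued Ω w) {q : Space n → Space n} {d : Space n → ℝ} (hq : Integrable q)
    (hd : Integrable d) (hq1 : ∀ x, ‖q x‖ ≤ 1) (hq0 : ∀ x ∉ Ω, q x = 0) (hd0 : ∀ x ∉ Ω, d x = 0)
    (hqd : ∀ φ : Space n → ℝ, ContDiff ℝ ∞ φ → HasCompactSupport φ →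
      ∫ x, fderiv ℝ φ x (q x) = - ∫ x, φ x * d x) :
    ∫ x in Ω, w x * d x ≤ C := by
  have hΩm : MeasurableSet Ω := hΩ.1.measurableSet
  obtain ⟨ι, ζ, e, c, hζ, hζc, hζ0, hζ1, hζs, he, hc, hc1, hcone⟩ := hΩ.exists_partition
  let F : ι → Space n → Space n := fun i x => ζ i x • q x
  let f : ι → Space n → ℝ := fun i x => ζ i x * d x + fderiv ℝ (ζ i) x (q x)
  have hF : ∀ i, Integrable (F i) := fun i => by
    obtain ⟨b, hb⟩ := (hζc i).exists_bound_of_continuous (hζ i).continuous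
    exact hq.bdd_smul b (hζ i).continuous.aestronglyMeasurable (Eventually.of_forall hb)
  have hf : ∀ i, Integrable (f i) := fun i => by
    obtain ⟨b, hb⟩ := (hζc i).exists_bound_of_continuous (hζ i).continuous
    have dζ : Continuous (fderiv ℝ (ζ i)) := (hζ i).continuous_fderiv (by simp)
    obtain ⟨B, hB⟩ := ((hζc i).fderiv (𝕜 := ℝ)).exists_bound_of_continuous dζ
    refine (hd.bdd_mul (hζ i).continuous.aestronglyMeasurable (Eventually.of_forall hb)).add ?_
    refine (hq.norm.const_mul B).mono' ?_ (Eventually.of_forall fun x =>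
      ((fderiv ℝ (ζ i) x).le_opNorm _).trans (mul_le_mul_of_nonneg_right (hB x) (norm_nonneg _)))
    exact (ContinuousLinearMap.id ℝ (Space n →L[ℝ] ℝ)).aestronglyMeasurable_comp₂
      dζ.aestronglyMeasurable hq.aestronglyMeasurable
  have hFf : ∀ i (φ : Space n → ℝ), ContDiff ℝ ∞ φ → HasCompactSupport φ →
      ∫ x, fderiv ℝ φ x (F i x) = - ∫ x, φ x * f i x := fun i φ hφ hφc =>
    integral_fderiv_apply_smul hq hd hqd (hζ i) (hζc i) hφ hφc
  have hsum : ∀ x, ∑ i, f i x = d x := by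
    intro x
    by_cases hx : x ∈ Ω
    · have h1 : ∑ i, ζ i x = 1 := hζs x (subset_closure hx)
      have h2 : ∑ i, fderiv ℝ (ζ i) x = 0 := by
        have hs : HasFDerivAt (fun y => ∑ i, ζ i y) (∑ i, fderiv ℝ (ζ i) x) x :=
          HasFDerivAt.fun_sum fun i _ => ((hζ i).differentiable (by simp) x).hasFDerivAt
        have hev : (fun y => ∑ i, ζ i y) =ᶠ[𝓝 x] fun _ => (1 : ℝ) := by
          filter_upwards [hΩ.1.mem_nhds hx] with y hy using hζs y (subset_closure hy)
        exact hs.unique ((hasFDerivAt_const (1 : ℝ) x).congr_of_eventuallyEq hev)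
      simp only [f, Finset.sum_add_distrib, ← Finset.sum_mul, h1, one_mul]
      rw [← sum_apply, h2]
      simp
    · simp [f, hq0 x hx, hd0 x hx]
  set N : ℝ := (Fintype.card ι : ℝ) with hN
  have main : ∀ ε > 0, ∫ x in Ω, w x * d x ≤ (1 + N * ε) * C + N * ε := by
    intro ε hε
    have hev : ∀ᶠ t : ℝ in 𝓝[>] 0, ∀ i,
        (∀ z ∈ tsupport (ζ i) ∩ closure Ω, ∀ y ∈ Metric.closedBall (t • e i) (c i * t),
          z + y ∈ Ω) ∧
        ∀ y ∈ Metric.closedBall (t • e i) (c i * t),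
          (∀ x, ζ i (x - y) ≤ ζ i x + ε) ∧ ∫ x, ‖f i (x - y) - f i x‖ ≤ ε := by
      refine eventually_all.2 fun i => (hcone i).and ?_
      refine eventually_forall_closedBall_smul (Filter.inter_mem ?_ ?_) (he i) (hc1 i)
      · have huc := (hζ i).continuous.uniformContinuous_of_tendsto_cocompact
          (hζc i).is_zero_at_infty
        obtain ⟨δ, hδ, hδε⟩ := Metric.uniformContinuous_iff.1 huc ε hε
        filter_upwards [Metric.ball_mem_nhds (0 : Space n) hδ] with y hy x
        have : dist (x - y) x < δ := by simpa [dist_eq_norm] using hy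
        have := (abs_lt.1 (hδε this)).2
        linarith
      · exact (tendsto_integral_norm_translate_sub (hf i)).eventually_le_const hε
    -- `t` is the length of the inward translations
    obtain ⟨t, ht, ht0⟩ := (hev.and eventually_mem_nhdsWithin).exists
    have ht0 : 0 < t := ht0
    choose κ hκ using fun i => exists_isMollifier (t • e i) (mul_pos (hc i) ht0)
    let P : Space n → Space n := fun x =>
      ∑ i, (κ i ⋆[ContinuousLinearMap.lsmul ℝ ℝ] F i) x
    have hPi : ∀ i, ContDiff ℝ 1 (κ i ⋆[ContinuousLinearMap.lsmul ℝ ℝ] F i) := fun i =>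
      (hκ i).contDiff_convolution (hF i)
    have hPc : ContDiff ℝ 1 P := ContDiff.sum fun i _ => hPi i
    have hdiv : ∀ x, divergence P x =
        ∑ i, (κ i ⋆[ContinuousLinearMap.lsmul ℝ ℝ] f i) x := by
      intro x
      have hP' : fderiv ℝ P x =
          ∑ i, fderiv ℝ (κ i ⋆[ContinuousLinearMap.lsmul ℝ ℝ] F i) x :=
        fderiv_fun_sum fun i _ => (hPi i).differentiable one_ne_zero x
      simp only [← fun i => (hκ i).divergence_convolution (hF i) (hFf i) x, divergence, hP']
      rw [Finset.sum_comm]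
      simp
    -- the support of `P` lies in a compact subset of `Ω`
    let S : Set (Space n) := ⋃ i, (tsupport (ζ i) ∩ closure Ω) +
      Metric.closedBall (t • e i) (c i * t)
    have hS : IsCompact S := isCompact_iUnion fun i =>
      ((hζc i).inter_right isClosed_closure).add (isCompact_closedBall _ _)
    have hSΩ : S ⊆ Ω := by
      refine iUnion_subset fun i => ?_
      rintro _ ⟨z, hz, y, hy, rfl⟩
      exact (ht i).1 z hz y hy
    have hPS : Function.support P ⊆ S := by
      intro x hx
      obtain ⟨i, -, hi⟩ := Finset.exists_ne_zero_of_sum_ne_zero hx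
      obtain ⟨y, hy, z, hz, hyz⟩ := support_convolution_subset _ hi
      refine mem_iUnion.2 ⟨i, z, ⟨subset_tsupport _ fun h0 => hz ?_, subset_closure ?_⟩, y,
        (hκ i).mem_of_ne_zero hy, by simpa [add_comm] using hyz⟩
      · simp [F, h0]
      · by_contra hzΩ
        exact hz (by simp [F, hq0 z hzΩ])
    have hPts : tsupport P ⊆ S := closure_minimal hPS hS.isClosed
    have hPnorm : ∀ x, ‖P x‖ ≤ 1 + N * ε := by
      intro x
      calc ‖P x‖ ≤ ∑ i, ‖(κ i ⋆[ContinuousLinearMap.lsmul ℝ ℝ] F i) x‖ := norm_sum_le _ _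
        _ ≤ ∑ i, (ζ i x + ε) := Finset.sum_le_sum fun i _ =>
            (hκ i).norm_convolution_le fun y hy => by
              rw [norm_smul, Real.norm_of_nonneg (hζ0 i _)]
              exact (mul_le_of_le_one_right (hζ0 i _) (hq1 _)).trans (((ht i).2 y hy).1 x)
        _ ≤ 1 + N * ε := by
            rw [Finset.sum_add_distrib]
            simp only [Finset.sum_const, Finset.card_univ, nsmul_eq_mul]
            linarith [hζ1 x]
    have hpos : 0 < 1 + N * ε := by positivity
    have hmem : (fun x => (1 + N * ε)⁻¹ • P x) ∈ tvFields Ω := by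
      have hs : tsupport (fun x => (1 + N * ε)⁻¹ • P x) ⊆ tsupport P :=
        tsupport_smul_subset_right (fun _ => (1 + N * ε)⁻¹) P
      refine ⟨hPc.const_smul _, hS.of_isClosed_subset (isClosed_tsupport _) (hs.trans hPts),
        (hs.trans hPts).trans hSΩ, fun x => ?_⟩
      rw [norm_smul, Real.norm_of_nonneg (inv_nonneg.2 hpos.le), inv_mul_le_one₀ hpos]
      exact hPnorm x
    have hle : ∫ x in Ω, w x * divergence P x ≤ (1 + N * ε) * C := by
      have := h _ hmem
      simp only [divergence_smul _ hPc, mul_left_comm (w _)] at this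
      rwa [integral_const_mul, inv_mul_le_iff₀ hpos] at this
    have hwm : ∀ {g : Space n → ℝ}, Integrable g → IntegrableOn (fun x => w x * g x) Ω :=
      fun hg => Integrable.bdd_mul hg.integrableOn hw.1 (Eventually.of_forall hw.abs_le)
    have hκf : ∀ i, Integrable (fun x => (κ i ⋆[ContinuousLinearMap.lsmul ℝ ℝ] f i) x) := fun i =>
      (hκ i).integrable_convolution (hf i)
    have hdivI : Integrable (divergence P) :=
      integrable_divergence hPc (hS.of_isClosed_subset (isClosed_tsupport _) hPts)
    have hdiff : (∫ x in Ω, w x * d x) - ∫ x in Ω, w x * divergence P x ≤ N * ε := by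
      have hnI : Integrable fun x =>
          ∑ i, ‖(κ i ⋆[ContinuousLinearMap.lsmul ℝ ℝ] f i) x - f i x‖ :=
        integrable_finsetSum _ fun i _ => ((hκf i).sub (hf i)).norm
      rw [← integral_sub (hwm hd) (hwm hdivI)]
      calc ∫ x in Ω, (w x * d x - w x * divergence P x)
          ≤ ∫ x in Ω, ∑ i, ‖(κ i ⋆[ContinuousLinearMap.lsmul ℝ ℝ] f i) x - f i x‖ := by
            refine integral_mono ((hwm hd).sub (hwm hdivI)) hnI.integrableOn fun x => ?_
            simp only [← mul_sub, hdiv, ← hsum x, ← Finset.sum_sub_distrib]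
            refine (le_abs_self _).trans ?_
            rw [abs_mul]
            refine (mul_le_of_le_one_left (abs_nonneg _) (hw.abs_le x)).trans ?_
            refine (Finset.abs_sum_le_sum_abs _ _).trans (Finset.sum_le_sum fun i _ => ?_)
            rw [abs_sub_comm, Real.norm_eq_abs]
        _ ≤ ∫ x, ∑ i, ‖(κ i ⋆[ContinuousLinearMap.lsmul ℝ ℝ] f i) x - f i x‖ :=
            setIntegral_le_integral hnI
              (Eventually.of_forall fun x => Finset.sum_nonneg fun i _ => norm_nonneg _)
        _ = ∑ i, ∫ x, ‖(κ i ⋆[ContinuousLinearMap.lsmul ℝ ℝ] f i) x - f i x‖ :=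
            integral_finsetSum _ fun i _ => ((hκf i).sub (hf i)).norm
        _ ≤ ∑ _i : ι, ε := Finset.sum_le_sum fun i _ =>
            (hκ i).integral_norm_convolution_sub_le (hf i) fun y hy => ((ht i).2 y hy).2
        _ = N * ε := by simp [hN]
    linarith
  have hlim : Tendsto (fun ε : ℝ => (1 + N * ε) * C + N * ε) (𝓝[>] 0) (𝓝 C) := by
    have : Tendsto (fun ε : ℝ => (1 + N * ε) * C + N * ε) (𝓝 0)
        (𝓝 ((1 + N * 0) * C + N * 0)) := Continuous.tendsto (by fun_prop) 0
    simp only [mul_zero, add_zero, one_mul] at this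
    exact this.mono_left nhdsWithin_le_nhds
  exact ge_of_tendsto hlim (eventually_mem_nhdsWithin.mono fun ε hε => main ε hε)

theorem memLp_weakDiv {n : ℕ} {Ω : Set (Space n)} {q : Space n → Space n} (hq : MemHdiv Ω q) :
    MemLp (weakDiv Ω q) 2 (volume.restrict Ω) := by
  rw [weakDiv, dif_pos hq.2]
  exact hq.2.choose_spec.1

theorem volume_ne_top {n : ℕ} {Ω : Set (Space n)} (hΩ : IsBoundedLipschitz Ω) : volume Ω ≠ ⊤ :=
  hΩ.2.1.measure_lt_top.ne

/-- Weak duality between the total variation and fields in `H_N(div, Ω)`. -/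
theorem TVLe.neg_integral_mul_weakDiv_le {n : ℕ} {Ω : Set (Space n)}
    (hΩ : IsBoundedLipschitz Ω) {w : Space n → ℝ} {C : ℝ} (h : TVLe Ω w C)
    (hw : IsUnitValued Ω w) {q : Space n → Space n} (hq : MemHN Ω q)
    (hq1 : ∀ᵐ x ∂(volume.restrict Ω), ‖q x‖ ≤ 1) :
    - ∫ x in Ω, w x * weakDiv Ω q x ≤ C := by
  have hΩm : MeasurableSet Ω := hΩ.1.measurableSet
  have : IsFiniteMeasure (volume.restrict Ω) := ⟨by simpa using (volume_ne_top hΩ).lt_top⟩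
  have hqi : IntegrableOn q Ω := hq.1.1.integrable one_le_two
  have hdi : IntegrableOn (weakDiv Ω q) Ω := (memLp_weakDiv hq.1).integrable one_le_two
  -- `q` is changed on a null set so that the bound `|q| ≤ 1` holds everywhere
  let q' : Space n → Space n := Ω.indicator ({x | ‖q x‖ ≤ 1}.indicator fun x => - q x)
  let d' : Space n → ℝ := Ω.indicator fun x => - weakDiv Ω q x
  have hqe : ({x | ‖q x‖ ≤ 1}.indicator fun x => - q x) =ᵐ[volume.restrict Ω] fun x => - q x :=
    hq1.mono fun x hx => indicator_of_mem (s := {x | ‖q x‖ ≤ 1}) hx _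
  have hq' : Integrable q' :=
    IntegrableOn.integrable_indicator (Integrable.congr hqi.neg hqe.symm) hΩm
  have hd' : Integrable d' := hdi.neg.integrable_indicator hΩm
  have key := h.integral_mul_weak_divergence_le hΩ hw (q := q') (d := d') hq' hd' (fun x => ?_)
    (fun x hx => indicator_of_notMem hx _) (fun x hx => indicator_of_notMem hx _)
    (fun φ hφ hφc => ?_)
  · refine le_trans (le_of_eq ?_) key
    rw [← integral_neg]
    exact setIntegral_congr_fun hΩm fun x hx => by simp [d', hx]
  · by_cases h1 : x ∈ Ω <;> by_cases h2 : ‖q x‖ ≤ 1 <;> simp [q', h1, h2]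
  · have dφ : Continuous (fderiv ℝ φ) := hφ.continuous_fderiv (by simp)
    obtain ⟨A, hA⟩ := (hφc.fderiv (𝕜 := ℝ)).exists_bound_of_continuous dφ
    obtain ⟨a, ha⟩ := hφc.exists_bound_of_continuous hφ.continuous
    have I1 : IntegrableOn (fun x => fderiv ℝ φ x (q x)) Ω := by
      refine Integrable.mono' (hqi.norm.const_mul A) ?_ (Eventually.of_forall fun x =>
        ((fderiv ℝ φ x).le_opNorm _).trans (mul_le_mul_of_nonneg_right (hA x) (norm_nonneg _)))
      exact (ContinuousLinearMap.id ℝ (Space n →L[ℝ] ℝ)).aestronglyMeasurable_comp₂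
        dφ.aestronglyMeasurable hqi.aestronglyMeasurable
    have I2 : IntegrableOn (fun x => φ x * weakDiv Ω q x) Ω :=
      Integrable.bdd_mul hdi hφ.continuous.aestronglyMeasurable (Eventually.of_forall ha)
    have h0 := hq.2 φ hφ hφc
    rw [integral_add I1 I2] at h0
    have e1 : ∫ x, fderiv ℝ φ x (q' x) = - ∫ x in Ω, fderiv ℝ φ x (q x) := by
      have : (fun x => fderiv ℝ φ x (q' x)) = Ω.indicator fun x =>
          fderiv ℝ φ x (({x | ‖q x‖ ≤ 1}.indicator fun x => - q x) x) := by
        ext x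
        by_cases hx : x ∈ Ω <;> simp [q', hx]
      rw [this, integral_indicator hΩm, ← integral_neg]
      refine integral_congr_ae (hqe.mono fun x hx => ?_)
      simp only [hx, map_neg]
    have e2 : ∫ x, φ x * d' x = - ∫ x in Ω, φ x * weakDiv Ω q x := by
      have : (fun x => φ x * d' x) = Ω.indicator fun x => - (φ x * weakDiv Ω q x) := by
        ext x
        by_cases hx : x ∈ Ω <;> simp [d', hx]
      rw [this, integral_indicator hΩm, integral_neg]
    rw [e1, e2]
    linarith

/-! ### The error estimate -/

theorem integrableOn_weight {n : ℕ} {Ω : Set (Space n)} (hfin : volume Ω ≠ ⊤)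
    {u₀ : Space n → ℝ} (hu₀ : MemLp u₀ 2 (volume.restrict Ω)) (ν k c : ℝ) :
    IntegrableOn (weight u₀ ν k c) Ω := by
  have : IsFiniteMeasure (volume.restrict Ω) := ⟨by simpa using hfin.lt_top⟩
  exact (((memLp_const c).sub hu₀).integrable_sq.const_mul (1 / ν)).add (integrable_const k)

theorem weight_nonneg {n : ℕ} (u₀ : Space n → ℝ) {ν k : ℝ} (hν : 0 < ν) (hk : 0 ≤ k) (c : ℝ)
    (x : Space n) : 0 ≤ weight u₀ ν k c x := by
  unfold weight; positivity

theorem le_weight_add_weight {n : ℕ} (u₀ : Space n → ℝ) {ν k : ℝ} (hν : 0 < ν) (hk : 0 ≤ k)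
    (c₁ c₂ : ℝ) (x : Space n) :
    (c₁ - c₂) ^ 2 / (2 * ν) ≤ weight u₀ ν k c₁ x + weight u₀ ν k c₂ x := by
  have h : (c₁ - c₂) ^ 2 / (2 * ν) = 1 / ν * ((c₁ - c₂) ^ 2 / 2) := by field_simp
  have h2 : (c₁ - c₂) ^ 2 / 2 ≤ (c₁ - u₀ x) ^ 2 + (c₂ - u₀ x) ^ 2 := by
    nlinarith [sq_nonneg (c₁ - u₀ x + (c₂ - u₀ x))]
  have h3 := mul_le_mul_of_nonneg_left h2 (by positivity : 0 ≤ 1 / ν)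
  unfold weight
  rw [h]
  linarith

theorem integrableOn_dualG {n : ℕ} {Ω : Set (Space n)} {θ₁ θ₂ d : Space n → ℝ}
    (h₁ : IntegrableOn θ₁ Ω) (h₂ : IntegrableOn θ₂ Ω) (h₁0 : ∀ x, 0 ≤ θ₁ x) (h₂0 : ∀ x, 0 ≤ θ₂ x)
    {s : ℝ} (hs : 0 < s) (hθ : ∀ x, s ≤ θ₁ x + θ₂ x) (hd : MemLp d 2 (volume.restrict Ω))
    (hd1 : IntegrableOn d Ω) :
    IntegrableOn (fun x => (1 / 4 * d x ^ 2 + d x * θ₂ x - θ₁ x * θ₂ x) / (θ₁ x + θ₂ x)) Ω := by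
  refine Integrable.mono' (((hd.integrable_sq.const_mul (1 / s)).add hd1.norm).add h₁) ?_
    (Eventually.of_forall fun x => ?_)
  · have a₁ := h₁.aestronglyMeasurable.aemeasurable
    have a₂ := h₂.aestronglyMeasurable.aemeasurable
    have ad := hd1.aestronglyMeasurable.aemeasurable
    exact (((((ad.pow_const 2).const_mul _).add (ad.mul a₂)).sub (a₁.mul a₂)).div
      (a₁.add a₂)).aestronglyMeasurable
  · have hpos : 0 < θ₁ x + θ₂ x := hs.trans_le (hθ x)
    have e1 : |1 / 4 * d x ^ 2 + d x * θ₂ x - θ₁ x * θ₂ x| ≤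
        d x ^ 2 + |d x| * θ₂ x + θ₁ x * θ₂ x := by
      refine (abs_sub _ _).trans ?_
      rw [abs_of_nonneg (mul_nonneg (h₁0 x) (h₂0 x))]
      have := abs_add_le (1 / 4 * d x ^ 2) (d x * θ₂ x)
      rw [abs_mul (d x), abs_of_nonneg (h₂0 x),
        abs_of_nonneg (by positivity : 0 ≤ 1 / 4 * d x ^ 2)] at this
      nlinarith [sq_nonneg (d x)]
    have e2 : d x ^ 2 ≤ (1 / s * d x ^ 2) * (θ₁ x + θ₂ x) := by
      have := mul_le_mul_of_nonneg_left (hθ x) (by positivity : 0 ≤ 1 / s * d x ^ 2)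
      have e : 1 / s * d x ^ 2 * s = d x ^ 2 := by field_simp
      linarith
    simp only [Pi.add_apply, Real.norm_eq_abs]
    rw [abs_div, abs_of_pos hpos, div_le_iff₀ hpos]
    nlinarith [mul_nonneg (abs_nonneg (d x)) (h₁0 x), mul_nonneg (h₁0 x) (h₁0 x)]

/-- The integrand of `E^rel[v] + D^rel[q]`, after use of the total variation bounds for the
rearrangement `V` of `v`, controls the square of the distance of `v` and `V`. -/
theorem mul_sq_le_integrand {a b d v V s : ℝ} (hs : 0 < s) (hab : s ≤ a + b)
    (hV : (V - 1 / 2) * (v - V) = 0) :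
    s * (v - V) ^ 2 ≤ v ^ 2 * a + (1 - v) ^ 2 * b - V * d - (a - b) * v + (a - b) * V +
      (1 / 4 * d ^ 2 + d * b - a * b) / (a + b) := by
  have hpos : 0 < a + b := hs.trans_le hab
  have e : v ^ 2 * a + (1 - v) ^ 2 * b - V * d - (a - b) * v + (a - b) * V +
      (1 / 4 * d ^ 2 + d * b - a * b) / (a + b) =
      (a + b) * (V - (b + d / 2) / (a + b)) ^ 2 + (a + b) * (v - V) ^ 2 +
        2 * (a + b) * ((V - 1 / 2) * (v - V)) := by
    field_simp
    ring
  rw [e, hV]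
  nlinarith [mul_nonneg hpos.le (sq_nonneg (V - (b + d / 2) / (a + b))),
    mul_le_mul_of_nonneg_right hab (sq_nonneg (v - V))]

/-- The distance of `v` to its rearrangement along a minimizer `χ` is controlled by the duality gap
of `v` and `q`. The rearrangement keeps the energy down, and weak duality bounds its relaxed energy
from below. -/
theorem mul_integral_sq_le {n : ℕ} {Ω : Set (Space n)} (hΩ : IsBoundedLipschitz Ω)
    {θ₁ θ₂ : Space n → ℝ} (h₁ : IntegrableOn θ₁ Ω) (h₂ : IntegrableOn θ₂ Ω)
    (h₁0 : ∀ x, 0 ≤ θ₁ x) (h₂0 : ∀ x, 0 ≤ θ₂ x) {s : ℝ} (hs : 0 < s)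
    (hθ : ∀ x, s ≤ θ₁ x + θ₂ x) {χ : Space n → ℝ} {m : ℝ} (hχ : IsUnitValued Ω χ)
    (hχ01 : ∀ x, χ x = 0 ∨ χ x = 1) (hχm : EnergyLe Ω (fun x => θ₁ x - θ₂ x) χ m)
    (hmin : ∀ z, IsUnitValued Ω z → (∀ x, z x = 0 ∨ z x = 1) →
      ∀ K, EnergyLe Ω (fun x => θ₁ x - θ₂ x) z K → m ≤ K)
    {v : Space n → ℝ} (hv : IsUnitValued Ω v) {C : ℝ} (hvC : TVLe Ω v C)
    {q : Space n → Space n} (hq : MemHN Ω q) (hq1 : ∀ᵐ x ∂(volume.restrict Ω), ‖q x‖ ≤ 1) :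
    s * ∫ x in Ω, (v x - max (min (v x) (1 / 2 * χ x + 1 / 2)) (1 / 2 * χ x)) ^ 2 ≤
      (∫ x in Ω, (v x ^ 2 * θ₁ x + (1 - v x) ^ 2 * θ₂ x)) + C +
        dualG Ω θ₁ θ₂ (weakDiv Ω q) := by
  have hfin := volume_ne_top hΩ
  have hfm : IsFiniteMeasure (volume.restrict Ω) := ⟨by simpa using hfin.lt_top⟩
  have hg : IntegrableOn (fun x => θ₁ x - θ₂ x) Ω := h₁.sub h₂
  have hd := memLp_weakDiv hq.1
  have hd1 : IntegrableOn (weakDiv Ω q) Ω := hd.integrable one_le_two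
  have hE : EnergyLe Ω (fun x => θ₁ x - θ₂ x) v (C + ∫ x in Ω, (θ₁ x - θ₂ x) * v x) :=
    TVLe.mono hvC (by linarith)
  have hr := EnergyLe.rearrange hΩ.1 hfin hg hχ hχm hmin hv hE
  set V : Space n → ℝ := fun x => max (min (v x) (1 / 2 * χ x + 1 / 2)) (1 / 2 * χ x) with hVd
  have hup := hχ.half_add_half
  have hlo := hχ.half
  have hV : IsUnitValued Ω V := (hv.min hup).max hlo
  have hV0 : ∀ x, (V x - 1 / 2) * (v x - V x) = 0 := fun x => by
    have hv0 := hv.2 x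
    have hv1 := hv.3 x
    rcases hχ01 x with h | h <;> simp only [hVd, h] <;> grind
  have hdual := TVLe.neg_integral_mul_weakDiv_le hΩ hr hV hq hq1
  have J1 : IntegrableOn (fun x => v x ^ 2 * θ₁ x + (1 - v x) ^ 2 * θ₂ x) Ω := by
    have b1 : ∀ x, ‖v x ^ 2‖ ≤ 1 := fun x => by
      rw [Real.norm_of_nonneg (sq_nonneg _)]; nlinarith [hv.2 x, hv.3 x]
    have b2 : ∀ x, ‖(1 - v x) ^ 2‖ ≤ 1 := fun x => by
      rw [Real.norm_of_nonneg (sq_nonneg _)]; nlinarith [hv.2 x, hv.3 x]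
    exact (Integrable.bdd_mul h₁ (hv.1.pow 2) (Eventually.of_forall b1)).add
      (Integrable.bdd_mul h₂ ((aestronglyMeasurable_const.sub hv.1).pow 2)
        (Eventually.of_forall b2))
  have J2 : IntegrableOn (fun x => V x * weakDiv Ω q x) Ω :=
    Integrable.bdd_mul hd1 hV.1 (Eventually.of_forall hV.abs_le)
  have J3 := hv.integrableOn_mul hg
  have J4 := hV.integrableOn_mul hg
  have J5 := integrableOn_dualG h₁ h₂ h₁0 h₂0 hs hθ hd hd1
  have J6 : IntegrableOn (fun x => (v x - V x) ^ 2) Ω := by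
    refine (integrable_const (1 : ℝ)).mono' ((hv.1.sub hV.1).pow 2)
      (Eventually.of_forall fun x => ?_)
    rw [Real.norm_of_nonneg (sq_nonneg _)]
    nlinarith [hv.2 x, hv.3 x, hV.2 x, hV.3 x]
  have key := integral_mono (J6.const_mul s) ((((J1.sub J2).sub J3).add J4).add J5) fun x =>
    mul_sq_le_integrand (d := weakDiv Ω q x) hs (hθ x) (hV0 x)
  rw [integral_const_mul] at key
  rw [integral_add' (((J1.sub J2).sub J3).add J4) J5, integral_add' ((J1.sub J2).sub J3) J4,
    integral_sub' (J1.sub J2) J3, integral_sub' J1 J2] at key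
  simp only [dualG]
  linarith

/-- Up to a constant, the binary functional is `∫ (θ₁ - θ₂) z + |Dz|`. -/
theorem energy_eq {n : ℕ} {Ω : Set (Space n)} {θ₁ θ₂ : Space n → ℝ} (h₁ : IntegrableOn θ₁ Ω)
    (h₂ : IntegrableOn θ₂ Ω) (h₁0 : ∀ x, 0 ≤ θ₁ x) (h₂0 : ∀ x, 0 ≤ θ₂ x) {z : Space n → ℝ}
    (hz : IsUnitValued Ω z) :
    energy Ω θ₁ θ₂ z =
      ENNReal.ofReal ((∫ x in Ω, (θ₁ x - θ₂ x) * z x) + ∫ x in Ω, θ₂ x) + totalVariation Ω z := by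
  have hg : IntegrableOn (fun x => θ₁ x - θ₂ x) Ω := h₁.sub h₂
  have e : ∀ x, (θ₁ x - θ₂ x) * z x + θ₂ x = θ₁ x * z x + θ₂ x * (1 - z x) := fun x => by ring
  have hi : IntegrableOn (fun x => (θ₁ x - θ₂ x) * z x + θ₂ x) Ω :=
    (hz.integrableOn_mul hg).add h₂
  rw [energy, ← integral_add (hz.integrableOn_mul hg) h₂, ofReal_integral_eq_lintegral_ofReal hi]
  · simp only [e]
  · refine Eventually.of_forall fun x => ?_
    simp only [Pi.zero_apply, e]
    exact add_nonneg (mul_nonneg (h₁0 x) (hz.2 x))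
      (mul_nonneg (h₂0 x) (sub_nonneg.2 (hz.3 x)))

/-- A minimizer agrees almost everywhere with a function that takes the values `0` and `1`
everywhere and minimizes `∫ (θ₁ - θ₂) z + |Dz|`, with minimal value `m`. -/
theorem IsBinaryMinimizer.exists_pointwise {n : ℕ} {Ω : Set (Space n)} {θ₁ θ₂ : Space n → ℝ}
    (hfin : volume Ω ≠ ⊤) (h₁ : IntegrableOn θ₁ Ω)
    (h₂ : IntegrableOn θ₂ Ω) (h₁0 : ∀ x, 0 ≤ θ₁ x) (h₂0 : ∀ x, 0 ≤ θ₂ x) {χ : Space n → ℝ}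
    (hχ : IsBinaryMinimizer Ω θ₁ θ₂ χ) :
    ∃ (χ' : Space n → ℝ) (m : ℝ), χ =ᵐ[volume.restrict Ω] χ' ∧ IsUnitValued Ω χ' ∧
      (∀ x, χ' x = 0 ∨ χ' x = 1) ∧ EnergyLe Ω (fun x => θ₁ x - θ₂ x) χ' m ∧
      ∀ z, IsUnitValued Ω z → (∀ x, z x = 0 ∨ z x = 1) →
        ∀ K, EnergyLe Ω (fun x => θ₁ x - θ₂ x) z K → m ≤ K := by
  classical
  obtain ⟨⟨hint, htv, h01⟩, hmin⟩ := hχ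
  let χ' : Space n → ℝ := fun x => if χ x = 1 then 1 else 0
  have hae : χ =ᵐ[volume.restrict Ω] χ' := h01.mono fun x hx => by
    rcases hx with h | h <;> simp [χ', h]
  have hχ' : IsUnitValued Ω χ' := ⟨hint.aestronglyMeasurable.congr hae,
    fun x => by simp only [χ']; split_ifs <;> norm_num,
    fun x => by simp only [χ']; split_ifs <;> norm_num⟩
  have hEχ : energy Ω θ₁ θ₂ χ =
      ENNReal.ofReal ((∫ x in Ω, (θ₁ x - θ₂ x) * χ' x) + ∫ x in Ω, θ₂ x) +
        totalVariation Ω χ := by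
    have e := energy_eq h₁ h₂ h₁0 h₂0 hχ'
    have e2 : totalVariation Ω χ = totalVariation Ω χ' := by
      refine iSup_congr fun p => iSup_congr fun _ => ?_
      have : ∫ x in Ω, χ x * divergence p x = ∫ x in Ω, χ' x * divergence p x :=
        integral_congr_ae (hae.mono fun x hx => by simp only [hx])
      rw [this]
    rw [e2, ← e, energy, energy, e2]
    congr 1
    exact lintegral_congr_ae (hae.mono fun x hx => by simp only [hx])
  have htvχ := (TVLe.of_totalVariation_lt_top htv).congr_ae hae
  refine ⟨χ', (totalVariation Ω χ).toReal + ∫ x in Ω, (θ₁ x - θ₂ x) * χ' x, hae, hχ',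
    fun x => ?_, TVLe.mono htvχ (by linarith), fun z hz hz01 K hK => ?_⟩
  · simp only [χ']; split_ifs <;> simp
  · have hztv : totalVariation Ω z ≤
        ENNReal.ofReal (K - ∫ x in Ω, (θ₁ x - θ₂ x) * z x) := TVLe.totalVariation_le hK
    have hle := hmin z ⟨hz.integrableOn hfin, hztv.trans_lt ENNReal.ofReal_lt_top,
      Eventually.of_forall hz01⟩
    have hz0 : 0 ≤ (∫ x in Ω, (θ₁ x - θ₂ x) * z x) + ∫ x in Ω, θ₂ x := by
      have hg : IntegrableOn (fun x => θ₁ x - θ₂ x) Ω := h₁.sub h₂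
      rw [← integral_add (hz.integrableOn_mul hg) h₂]
      refine integral_nonneg fun x => ?_
      simp only [Pi.zero_apply]
      nlinarith [mul_nonneg (h₁0 x) (hz.2 x), mul_nonneg (h₂0 x) (sub_nonneg.2 (hz.3 x))]
    rw [hEχ, energy_eq h₁ h₂ h₁0 h₂0 hz] at hle
    have hle2 := hle.trans (add_le_add_right hztv _)
    rw [← ENNReal.ofReal_add hz0 (TVLe.nonneg hK), ← ENNReal.ofReal_toReal htv.ne] at hle2
    have hle3 := (ENNReal.ofReal_add_le).trans hle2
    rw [ENNReal.ofReal_le_ofReal_iff (add_nonneg hz0 (TVLe.nonneg hK))] at hle3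
    linarith

theorem TVLe.clamp {n : ℕ} {Ω : Set (Space n)} (hΩ : IsOpen Ω) (hfin : volume Ω ≠ ⊤)
    {v : Space n → ℝ} {C : ℝ} (hv : IntegrableOn v Ω) (h : TVLe Ω v C) :
    TVLe Ω (fun x => max (min (v x) 1) 0) C := by
  have : IsFiniteMeasure (volume.restrict Ω) := ⟨by simpa using hfin.lt_top⟩
  have hc : ∀ c : ℝ, IntegrableOn (fun _ => c) Ω := fun c => integrable_const c
  obtain ⟨a, b, hab, ha, hb⟩ := h.exists_min_max hΩ hv (hc 1) (TVLe.const Ω 1)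
  obtain ⟨a', b', hab', ha', hb'⟩ :=
    ha.exists_min_max hΩ (hv.inf (hc 1)) (hc 0) (TVLe.const Ω 0)
  exact hb'.mono (by linarith [hb.nonneg, ha'.nonneg])

/-- A point misclassified by `v` outside the band `|v - 1/2| ≤ η` has truncated value at distance
at least `η` from its rearrangement `1/2`. The truncation to `[0, 1]` keeps this distance as
`η < 1/2`. -/
theorem abs_sub_indicator_le {χ v η : ℝ} (hχ : χ = 0 ∨ χ = 1) (hη0 : 0 < η) (hη1 : η < 1 / 2) :
    |χ - (if 1 / 2 < v then 1 else 0)| ≤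
      (if 1 / 2 - η ≤ v ∧ v ≤ 1 / 2 + η then 1 else 0) + 1 / η ^ 2 *
        (max (min v 1) 0 -
          max (min (max (min v 1) 0) (1 / 2 * χ + 1 / 2)) (1 / 2 * χ)) ^ 2 := by
  set w := max (min v 1) 0 with hw
  set V := max (min w (1 / 2 * χ + 1 / 2)) (1 / 2 * χ) with hV
  have hrest : 0 ≤ 1 / η ^ 2 * (w - V) ^ 2 := by positivity
  have hfar : η ≤ |w - V| → 1 ≤ 1 / η ^ 2 * (w - V) ^ 2 := fun h => by
    rw [div_mul_eq_mul_div, one_mul, one_le_div (by positivity), ← sq_abs (w - V)]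
    gcongr
  have habs : |χ - (if 1 / 2 < v then 1 else 0)| ≤ 1 := by
    rcases hχ with h | h <;> rw [h] <;> split_ifs <;> norm_num
  by_cases hmid : 1 / 2 - η ≤ v ∧ v ≤ 1 / 2 + η
  · rw [if_pos hmid]; linarith
  rw [if_neg hmid, zero_add]
  rcases lt_or_ge v (1 / 2 - η) with hlow | hlow
  · rw [if_neg (by linarith)]
    rcases hχ with h | h
    · rw [h, sub_zero, abs_zero]; exact hrest
    · rw [if_neg (by linarith)] at habs
      refine habs.trans (hfar ?_)
      have hw1 : w < 1 / 2 - η := max_lt (min_lt_iff.2 (Or.inl hlow)) (by linarith)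
      have hVw : V ≥ 1 / 2 := by rw [hV, h]; exact le_max_of_le_right (by norm_num)
      rw [abs_sub_comm]
      exact le_trans (by linarith) (le_abs_self _)
  · have hhigh : 1 / 2 + η < v := by
      by_contra hcon
      exact hmid ⟨hlow, not_lt.1 hcon⟩
    rw [if_pos (by linarith)]
    rcases hχ with h | h
    · rw [if_pos (by linarith)] at habs
      refine habs.trans (hfar ?_)
      have hw1 : 1 / 2 + η < w := lt_max_of_lt_left (lt_min hhigh (by linarith))
      have hVw : V ≤ 1 / 2 := by
        rw [hV, h]; exact max_le ((min_le_right _ _).trans (by norm_num)) (by norm_num)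
      exact le_trans (by linarith) (le_abs_self _)
    · rw [h, sub_self, abs_zero]; exact hrest

/-- Truncation to `[0, 1]` does not increase the quadratic part of the relaxed functional. -/
theorem integral_clamp_add_totalVariation_le {n : ℕ} {Ω : Set (Space n)} {θ₁ θ₂ : Space n → ℝ}
    (h₁ : IntegrableOn θ₁ Ω) (h₂ : IntegrableOn θ₂ Ω) (h₁0 : ∀ x, 0 ≤ θ₁ x)
    (h₂0 : ∀ x, 0 ≤ θ₂ x) {v : Space n → ℝ}
    (hv : AEStronglyMeasurable v (volume.restrict Ω)) (hfin : relEnergy Ω θ₁ θ₂ v ≠ ⊤) :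
    (∫ x in Ω, (max (min (v x) 1) 0 ^ 2 * θ₁ x + (1 - max (min (v x) 1) 0) ^ 2 * θ₂ x)) +
      (totalVariation Ω v).toReal ≤ (relEnergy Ω θ₁ θ₂ v).toReal := by
  rw [relEnergy] at hfin ⊢
  obtain ⟨hA, hB⟩ := ENNReal.add_ne_top.1 hfin
  rw [ENNReal.toReal_add hA hB]
  refine add_le_add_left ?_ _
  have am : AEStronglyMeasurable (fun x => max (min (v x) 1) 0) (volume.restrict Ω) :=
    (hv.inf aestronglyMeasurable_const).sup aestronglyMeasurable_const
  rw [integral_eq_lintegral_of_nonneg_ae]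
  · refine ENNReal.toReal_mono hA (lintegral_mono fun x => ENNReal.ofReal_le_ofReal ?_)
    have e1 : max (min (v x) 1) 0 ^ 2 ≤ v x ^ 2 := by
      rw [sq_le_sq]
      grind
    have e2 : (1 - max (min (v x) 1) 0) ^ 2 ≤ (1 - v x) ^ 2 := by
      rw [sq_le_sq]
      grind
    exact add_le_add (mul_le_mul_of_nonneg_right e1 (h₁0 x))
      (mul_le_mul_of_nonneg_right e2 (h₂0 x))
  · exact Eventually.of_forall fun x => add_nonneg (mul_nonneg (sq_nonneg _) (h₁0 x))
      (mul_nonneg (sq_nonneg _) (h₂0 x))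
  · exact ((am.pow 2).mul h₁.aestronglyMeasurable).add
      (((aestronglyMeasurable_const.sub am).pow 2).mul h₂.aestronglyMeasurable)

end BinaryMS

theorem theorem2 {n : ℕ} (Ω : Set (BinaryMS.Space n)) (hΩ : BinaryMS.IsBoundedLipschitz Ω)
    (u₀ : BinaryMS.Space n → ℝ) (hu₀ : MemLp u₀ 2 (volume.restrict Ω))
    (ν k c₁ c₂ : ℝ) (hν : 0 < ν) (hk : 0 ≤ k) (hc : c₁ ≠ c₂)
    (χ : BinaryMS.Space n → ℝ)
    (hχ : BinaryMS.IsBinaryMinimizer Ω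
      (BinaryMS.weight u₀ ν k c₁) (BinaryMS.weight u₀ ν k c₂) χ)
    (v : BinaryMS.Space n → ℝ) (hv : MemLp v 2 (volume.restrict Ω))
    (q : BinaryMS.Space n → BinaryMS.Space n) (hq : BinaryMS.MemHN Ω q) :
    ((eLpNorm (fun x => χ x - indicator {y | 1 / 2 < v y} (fun _ => (1 : ℝ)) x) 1
        (volume.restrict Ω) : ℝ≥0∞) : EReal)
      ≤ BinaryMS.errChi Ω u₀ ν k c₁ c₂ v q := by
  classical
  set θ₁ := BinaryMS.weight u₀ ν k c₁ with hθ₁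
  set θ₂ := BinaryMS.weight u₀ ν k c₂ with hθ₂
  have hfin := BinaryMS.volume_ne_top hΩ
  have hfm : IsFiniteMeasure (volume.restrict Ω) := ⟨by simpa using hfin.lt_top⟩
  have h₁ : IntegrableOn θ₁ Ω := BinaryMS.integrableOn_weight hfin hu₀ ν k c₁
  have h₂ : IntegrableOn θ₂ Ω := BinaryMS.integrableOn_weight hfin hu₀ ν k c₂
  have h₁0 : ∀ x, 0 ≤ θ₁ x := BinaryMS.weight_nonneg u₀ hν hk c₁
  have h₂0 : ∀ x, 0 ≤ θ₂ x := BinaryMS.weight_nonneg u₀ hν hk c₂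
  have hc0 : 0 < (c₁ - c₂) ^ 2 := by have := sub_ne_zero.2 hc; positivity
  have hs : 0 < (c₁ - c₂) ^ 2 / (2 * ν) := by positivity
  have hθ := BinaryMS.le_weight_add_weight u₀ hν hk c₁ c₂
  have hfac : 0 < 2 * ν / (c₁ - c₂) ^ 2 := by positivity
  refine le_iInf₂ fun η hη => ?_
  obtain ⟨hη0, hη1⟩ := hη
  have hη2 : 0 < 1 / η ^ 2 := by positivity
  -- an infinite estimator makes the bound trivial
  have htop : BinaryMS.errUSq Ω u₀ ν k c₁ c₂ v q = ⊤ →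
      ((eLpNorm (fun x => χ x - indicator {y | 1 / 2 < v y} (fun _ => (1 : ℝ)) x) 1
        (volume.restrict Ω) : ℝ≥0∞) : EReal) ≤ (BinaryMS.unidentified Ω v η : EReal) +
        ((1 / η ^ 2 : ℝ) : EReal) * BinaryMS.errUSq Ω u₀ ν k c₁ c₂ v q := fun h => by
    rw [h, EReal.coe_mul_top_of_pos hη2, EReal.add_top_of_ne_bot (EReal.coe_ennreal_ne_bot _)]
    exact le_top
  by_cases hq1 : ∀ᵐ x ∂(volume.restrict Ω), ‖q x‖ ≤ 1
  swap
  · refine htop ?_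
    rw [BinaryMS.errUSq, BinaryMS.dualEnergy, BinaryMS.dualF, if_neg hq1,
      EReal.top_add_coe, EReal.add_top_of_ne_bot (EReal.coe_ennreal_ne_bot _),
      EReal.coe_mul_top_of_pos hfac]
  by_cases hrel : BinaryMS.relEnergy Ω θ₁ θ₂ v = ⊤
  · refine htop ?_
    rw [BinaryMS.errUSq, BinaryMS.dualEnergy, BinaryMS.dualF, if_pos hq1, ← hθ₁, ← hθ₂, hrel,
      zero_add, EReal.coe_ennreal_top, EReal.top_add_coe, EReal.coe_mul_top_of_pos hfac]
  have htv : BinaryMS.totalVariation Ω v < ⊤ :=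
    lt_top_iff_ne_top.2 (ENNReal.add_ne_top.1 hrel).2
  obtain ⟨χ', m, hae, hχ', hχ01, hχm, hmin⟩ :=
    BinaryMS.IsBinaryMinimizer.exists_pointwise hfin h₁ h₂ h₁0 h₂0 hχ
  have hvi : IntegrableOn v Ω := hv.integrable one_le_two
  have hw : BinaryMS.IsUnitValued Ω (fun x => max (min (v x) 1) 0) :=
    BinaryMS.IsUnitValued.comp (f := fun t => max (min t 1) 0) (by fun_prop)
      (fun _ => le_max_right _ _) (fun _ => max_le (min_le_right _ _) zero_le_one) hv.1
  have hwC := (BinaryMS.TVLe.of_totalVariation_lt_top htv).clamp hΩ.1 hfin hvi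
  have hmain := BinaryMS.mul_integral_sq_le hΩ h₁ h₂ h₁0 h₂0 hs hθ hχ' hχ01 hχm hmin hw hwC hq hq1
  have hrelge := BinaryMS.integral_clamp_add_totalVariation_le h₁ h₂ h₁0 h₂0 hv.1 hrel
  set D := BinaryMS.dualG Ω θ₁ θ₂ (BinaryMS.weakDiv Ω q) with hD
  set R := BinaryMS.relEnergy Ω θ₁ θ₂ v with hR
  -- `W` is the squared distance of the truncation of `v` to its rearrangement along `χ'`
  set W : BinaryMS.Space n → ℝ := fun x => (max (min (v x) 1) 0 - max (min (max (min (v x) 1) 0)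
    (1 / 2 * χ' x + 1 / 2)) (1 / 2 * χ' x)) ^ 2 with hW
  have hsq : ∫ x in Ω, W x ≤ 2 * ν / (c₁ - c₂) ^ 2 * (R.toReal + D) := by
    have e : 2 * ν / (c₁ - c₂) ^ 2 = ((c₁ - c₂) ^ 2 / (2 * ν))⁻¹ := by rw [inv_div]
    rw [e, ← div_eq_inv_mul, le_div_iff₀ hs, mul_comm]
    linarith
  have herr : BinaryMS.errUSq Ω u₀ ν k c₁ c₂ v q =
      ((2 * ν / (c₁ - c₂) ^ 2 * (R.toReal + D) : ℝ) : EReal) := by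
    rw [BinaryMS.errUSq, BinaryMS.dualEnergy, BinaryMS.dualF, if_pos hq1, zero_add, ← hθ₁, ← hθ₂,
      ← hR, ← hD, EReal.coe_mul, EReal.coe_add, EReal.coe_ennreal_toReal hrel]
  have hWm : AEStronglyMeasurable W (volume.restrict Ω) :=
    (hw.1.sub ((hw.1.inf ((hχ'.1.const_mul _).add_const _)).sup (hχ'.1.const_mul _))).pow 2
  have hWi : IntegrableOn W Ω := by
    refine (integrable_const (1 : ℝ)).mono' hWm (Filter.Eventually.of_forall fun x => ?_)
    rw [Real.norm_of_nonneg (sq_nonneg _)]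
    have a1 := hw.2 x
    have a2 := hw.3 x
    have a3 := hχ'.2 x
    have a4 := hχ'.3 x
    have b1 : 0 ≤ max (min (max (min (v x) 1) 0) (1 / 2 * χ' x + 1 / 2)) (1 / 2 * χ' x) :=
      le_max_of_le_right (by linarith)
    have b2 : max (min (max (min (v x) 1) 0) (1 / 2 * χ' x + 1 / 2)) (1 / 2 * χ' x) ≤ 1 :=
      max_le ((min_le_left _ _).trans a2) (by linarith)
    nlinarith
  have hnorm : eLpNorm (fun x => χ x - indicator {y | 1 / 2 < v y} (fun _ => (1 : ℝ)) x) 1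
      (volume.restrict Ω) ≤ BinaryMS.unidentified Ω v η +
        ENNReal.ofReal (1 / η ^ 2 * ∫ x in Ω, W x) := by
    rw [BinaryMS.unidentified, eLpNorm_one_eq_lintegral_enorm, eLpNorm_one_eq_lintegral_enorm,
      ← integral_const_mul, ofReal_integral_eq_lintegral_ofReal (hWi.const_mul _)
      (Filter.Eventually.of_forall fun x => mul_nonneg hη2.le (sq_nonneg _)),
      ← lintegral_add_right' _ (hWm.aemeasurable.const_mul _).ennreal_ofReal]
    refine lintegral_mono_ae (hae.mono fun x hx => ?_)
    have key := BinaryMS.abs_sub_indicator_le (v := v x) (hχ01 x) hη0 hη1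
    simp only [hx, indicator_apply, mem_ofPred_eq, Real.enorm_eq_ofReal_abs]
    rw [← ENNReal.ofReal_add (abs_nonneg _) (mul_nonneg hη2.le (sq_nonneg _))]
    refine ENNReal.ofReal_le_ofReal (key.trans (add_le_add_left (le_abs_self _) _))
  rw [herr, ← EReal.coe_mul]
  refine (EReal.coe_ennreal_le_coe_ennreal_iff.2 hnorm).trans ?_
  rw [EReal.coe_ennreal_add]
  refine add_le_add_right ?_ _
  have hW0 : 0 ≤ 1 / η ^ 2 * ∫ x in Ω, W x :=
    mul_nonneg hη2.le (integral_nonneg fun x => sq_nonneg _)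
  rw [EReal.coe_ennreal_ofReal, max_eq_left hW0]
  exact EReal.coe_le_coe_iff.2 (mul_le_mul_of_nonneg_left hsq hη2.le)
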